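/- For a finite group $G$ let $\rho(G)=\prod_{g\in G} o(g)$ be the product of the orders of its elements, and let $\operatorname{Exp}_\rho(G)$ be the set of exponents in the prime factorization of $\rho(G)$, that is, if $\rho(G)=p_1^{\alpha_1}\cdots p_k^{\alpha_k}$ with distinct primes $p_i$ and all $\alpha_i\ge 1$, then $\operatorname{Exp}_\rho(G)=\{\alpha_1,\dots,\alpha_k\}$. Let $\mathbb{Z}_n$ be the cyclic group of order $n$, and let $\mathbb{Z}_{13}\rtimes\mathbb{Z}_3$ be the non-abelian group of order $39$, in which a generator of $\mathbb{Z}_3$ acts on $\mathbb{Z}_{13}$ as multiplication by $3$. Theorem. One has $\operatorname{Exp}_\rho(\mathrm{PSL}(2,13))=\{168,273,364,468\}$. For every finite group $G$: 1. $\operatorname{Exp}_\rho(G)=\operatorname{Exp}_\rho(\mathrm{PSL}(2,13))$ if and only if $G\cong\mathrm{PSL}(2,13)$ or $G\cong\mathbb{Z}_{14}\times(\mathbb{Z}_{13}\rtimes\mathbb{Z}_3)$. 2. $\operatorname{Exp}_\rho(G)=\operatorname{Exp}_\rho(\mathrm{PSL}(2,13))$ and $|G|=|\mathrm{PSL}(2,13)|$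 if and only if $G\cong\mathrm{PSL}(2,13)$. -/

import Mathlib

/-- The product of element orders `ρ(G) = ∏_{g ∈ G} o(g)`, for a finite group `G`. -/
noncomputable def rhoProd (G : Type*) [Group G] [Finite G] : ℕ :=
  ∏ᶠ g : G, orderOf g

/-- The set of the (positive) exponents in the prime factorization of `n`. -/
def expSet (n : ℕ) : Set ℕ :=
  {a | ∃ p : ℕ, p.Prime ∧ p ∣ n ∧ n.factorization p = a}

/-- `Exp_ρ(G)`: the set of exponents in the prime factorization of `ρ(G)`. -/
noncomputable def ExpRho (G : Type*) [Group G] [Finite G] : Set ℕ :=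
  expSet (rhoProd G)

/-- `PSL(2, 13)`. -/
abbrev PSL2_13 : Type :=
  Matrix.ProjectiveSpecialLinearGroup (Fin 2) (ZMod 13)

/-- The faithful action of `ℤ/3` on `ℤ/13` in which `k` acts as multiplication by `3 ^ k`
(the class of `3` has multiplicative order `3` modulo `13`, with inverse `9`). -/
def actZ3Z13 : Multiplicative (ZMod 3) →* MulAut (Multiplicative (ZMod 13)) where
  toFun k :=
    { toFun := fun x => Multiplicative.ofAdd ((3 : ZMod 13) ^ k.toAdd.val * x.toAdd)
      invFun := fun x => Multiplicative.ofAdd ((9 : ZMod 13) ^ k.toAdd.val * x.toAdd)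
      left_inv := by revert k; decide
      right_inv := by revert k; decide
      map_mul' := fun x y => by simp [mul_add] }
  map_one' := by ext x; revert x; decide
  map_mul' := fun k l => by
    ext x
    revert k l x
    decide

/-- The non-abelian group `ℤ_13 ⋊ ℤ_3` of order `39`. -/
abbrev Z13Z3 : Type :=
  Multiplicative (ZMod 13) ⋊[actZ3Z13] Multiplicative (ZMod 3)

/-- The group `ℤ_14 × (ℤ_13 ⋊ ℤ_3)` of order `546`. -/
abbrev Z14Z13Z3 : Type :=
  Multiplicative (ZMod 14) × Z13Z3

-- Let $e_p(G)$ (`orderExp p G`) be the exponent of $p$ in $\rho(G)$. It is divisible by every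
-- divisor of $|G|$ prime to $p$ (`dvd_orderExp`). This follows from Frobenius' theorem on the
-- number of $q$-elements, after each element is split into commuting $q'$- and $q$-parts. For odd
-- $p$ it is also even, by pairing $g$ with $g^{-1}$. These two facts recover from the bare set
-- $\{168,273,364,468\}$ which prime carries which exponent, and force $|G|$ to be 546 or 1092
-- (`card_of_ExpRho_eq`).
--
-- For a Sylow $p$-subgroup $P$ of order $p$, `orderExp_mul_prime` gives $p\,e_p(G)=n_p(p-1)|C(P)|$.
--
-- If $|G|=546$, this yields $C(P)=N(P)$ for $p=2,3,7$. Burnside transfer then leaves $G'$ of order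
-- 13, with a cyclic complement of order 42 whose generator acts on $G'$ with order 3, so $G$ is the
-- product group.
--
-- If $|G|=1092$, there is either one Sylow 13-subgroup or there are 14. One is impossible: a
-- quadratic character would give too many elements of even order. So $G$ acts faithfully on 14
-- Sylow subgroups, labelled as the projective line over $\mathbb F_{13}$ with point stabilizers
-- acting by $x\mapsto sx+b$, $s$ a nonzero square. A finite check shows that an element swapping
-- $0$ and $\infty$ must be $x\mapsto -r^2/x$, which puts $G$ inside the image of
-- $\mathrm{PSL}(2,13)$; orders finish the argument (`nonempty_mulEquiv_of_card_1092`).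
--
-- Conversely, the exponents of $\mathrm{PSL}(2,13)$ come from counting matrices by trace, and those
-- of the product group from counting solutions of $g^m=1$.

universe u
-- Frobenius' theorem on the number of $q$-elements
open Finset in
theorem Nat.exists_split_idempotents {a b : ℕ} (h : a.Coprime b) :
    ∃ e f : ℕ, a ∣ e ∧ b ∣ f ∧ e ≡ 1 [MOD b] ∧ f ≡ 1 [MOD a] ∧ e + f ≡ 1 [MOD a * b] := by
  obtain ⟨e, h1, h2⟩ := Nat.chineseRemainder h 0 1
  obtain ⟨f, h3, h4⟩ := Nat.chineseRemainder h 1 0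
  refine ⟨e, f, (Nat.modEq_zero_iff_dvd).1 h1, (Nat.modEq_zero_iff_dvd).1 h4, h2, h3, ?_⟩
  exact (Nat.modEq_and_modEq_iff_modEq_mul h).1
    ⟨by simpa using h1.add h3, by simpa using h2.add h4⟩

theorem pow_eq_self_of_modEq_one {G : Type*} [Group G] {g : G} {e n : ℕ} (h : g ^ n = 1)
    (he : e ≡ 1 [MOD n]) : g ^ e = g := by
  have := pow_eq_pow_iff_modEq.2 (he.of_dvd (orderOf_dvd_of_pow_eq_one h))
  simpa using this

theorem pow_eq_one_of_dvd_of_pow_eq_one {G : Type*} [Group G] {g : G} {e n : ℕ} (h : g ^ n = 1)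
    (he : n ∣ e) : g ^ e = 1 := by
  obtain ⟨k, rfl⟩ := he
  rw [pow_mul, h, one_pow]

section
variable {G : Type*} [Group G] {q : ℕ}

theorem pow_ordCompl_eq_one_iff [Finite G] (hq : q.Prime) (y : G) :
    y ^ (ordCompl[q] (Nat.card G)) = 1 ↔ ¬ q ∣ orderOf y := by
  have hn : Nat.card G ≠ 0 := Nat.card_pos.ne'
  rw [← orderOf_dvd_iff_pow_eq_one]
  constructor
  · intro h h2
    exact Nat.not_dvd_ordCompl hq hn (h2.trans h)
  · intro h
    have h1 : orderOf y ∣ ordProj[q] (Nat.card G) * ordCompl[q] (Nat.card G) := by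
      rw [Nat.ordProj_mul_ordCompl_eq_self]; exact orderOf_dvd_natCard y
    exact (Nat.Coprime.pow_right _ ((Nat.Prime.coprime_iff_not_dvd hq).2 h).symm).dvd_of_dvd_mul_left h1

theorem pow_ordProj_eq_one_iff [Finite G] (hq : q.Prime) (u : G) :
    u ^ (ordProj[q] (Nat.card G)) = 1 ↔ ∃ k : ℕ, u ^ q ^ k = 1 := by
  refine ⟨fun h => ⟨_, h⟩, fun ⟨k, hk⟩ => ?_⟩
  have hn : Nat.card G ≠ 0 := Nat.card_pos.ne'
  rw [← orderOf_dvd_iff_pow_eq_one] at hk ⊢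
  obtain ⟨j, -, hj⟩ := (Nat.dvd_prime_pow hq).1 hk
  rw [hj]
  apply pow_dvd_pow
  rw [← hq.pow_dvd_iff_le_factorization hn, ← hj]
  exact orderOf_dvd_natCard u

open Finset in
open scoped Classical in
-- Every element is uniquely a product of commuting $q'$- and $q$-elements; grouping the sum by the
-- $q'$-part $y$ leaves the $q$-elements of $C(y)$ to be counted.
theorem sum_eq_sum_primeToPart [Fintype G] (hq : q.Prime) (F : G → ℕ)
    (hF : ∀ y u : G, Commute y u → ¬ q ∣ orderOf y → (∃ k : ℕ, u ^ q ^ k = 1) → F (y * u) = F y) :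
    ∑ g : G, F g = ∑ y ∈ univ.filter (fun y : G => ¬ q ∣ orderOf y),
      F y * #(univ.filter fun u : G => Commute y u ∧ ∃ k : ℕ, u ^ q ^ k = 1) := by
  have hn : Nat.card G ≠ 0 := Nat.card_pos.ne'
  have hc : (ordProj[q] (Nat.card G)).Coprime (ordCompl[q] (Nat.card G)) :=
    (Nat.coprime_ordCompl hq hn).pow_left _
  have hmul := Nat.ordProj_mul_ordCompl_eq_self (Nat.card G) q
  -- The two parts of $g$ are the powers $g^e$ (the $q'$-part) and $g^f$ (the $q$-part).
  obtain ⟨e, f, he0, hf0, he1, hf1, hef⟩ := Nat.exists_split_idempotents hc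
  rw [hmul] at hef
  have hcard (g : G) : g ^ Nat.card G = 1 := pow_card_eq_one'
  have e1 (y : G) (hy : ¬ q ∣ orderOf y) : y ^ e = y :=
    pow_eq_self_of_modEq_one ((pow_ordCompl_eq_one_iff hq y).2 hy) he1
  have e0 (u : G) (hu : ∃ k : ℕ, u ^ q ^ k = 1) : u ^ e = 1 :=
    pow_eq_one_of_dvd_of_pow_eq_one ((pow_ordProj_eq_one_iff hq u).2 hu) he0
  have f0 (y : G) (hy : ¬ q ∣ orderOf y) : y ^ f = 1 :=
    pow_eq_one_of_dvd_of_pow_eq_one ((pow_ordCompl_eq_one_iff hq y).2 hy) hf0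
  have f1 (u : G) (hu : ∃ k : ℕ, u ^ q ^ k = 1) : u ^ f = u :=
    pow_eq_self_of_modEq_one ((pow_ordProj_eq_one_iff hq u).2 hu) hf1
  have hy (g : G) : ¬ q ∣ orderOf (g ^ e) := by
    rw [← pow_ordCompl_eq_one_iff hq, ← pow_mul]
    exact pow_eq_one_of_dvd_of_pow_eq_one (hcard g) (hmul.symm.dvd.trans (mul_dvd_mul_right he0 _))
  have hu (g : G) : ∃ k : ℕ, (g ^ f) ^ q ^ k = 1 := by
    rw [← pow_ordProj_eq_one_iff hq, ← pow_mul, mul_comm]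
    exact pow_eq_one_of_dvd_of_pow_eq_one (hcard g) (hmul.symm.dvd.trans (mul_dvd_mul_left _ hf0))
  have hg (g : G) : g ^ e * g ^ f = g := by
    rw [← pow_add]; exact pow_eq_self_of_modEq_one (hcard g) hef
  have hcomm (g : G) : Commute (g ^ e) (g ^ f) := Commute.pow_pow_self g e f
  have : ∀ y : G, F y * #(univ.filter fun u : G => Commute y u ∧ ∃ k : ℕ, u ^ q ^ k = 1) =
      ∑ u ∈ univ.filter (fun u : G => Commute y u ∧ ∃ k : ℕ, u ^ q ^ k = 1), F y := by
    intro y; simp [mul_comm]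
  simp only [this]
  rw [Finset.sum_sigma']
  refine Finset.sum_nbij' (fun g => ⟨g ^ e, g ^ f⟩) (fun x => x.1 * x.2) ?_ ?_ ?_ ?_ ?_
  · intro g _
    simp only [mem_sigma, mem_filter, mem_univ, true_and]
    exact ⟨hy g, hcomm g, hu g⟩
  · simp
  · intro g _; exact hg g
  · rintro ⟨y, u⟩ h
    simp only [mem_sigma, mem_filter, mem_univ, true_and] at h
    obtain ⟨h1, h2, h3⟩ := h
    simp [h2.mul_pow, e1 y h1, e0 u h3, f0 y h1, f1 u h3]
  · intro g _
    conv_lhs => rw [← hg g]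
    exact hF _ _ (hcomm g) (hy g) (hu g)

open Finset in
open scoped Classical in
-- The class of $y$ contributes $|G:C(y)|\,h(y)$, and the $q$-parts of $|G:C(y)|$ and $|C(y)|$
-- multiply to that of $|G|$.
theorem ordProj_dvd_sum_of_class_function [Fintype G] (h : G → ℕ)
    (hconj : ∀ x y : G, IsConj x y → h x = h y)
    (hdvd : ∀ y : G, ordProj[q] (Nat.card (Subgroup.centralizer {y})) ∣ h y) :
    ordProj[q] (Nat.card G) ∣ ∑ y, h y := by
  rw [← Finset.sum_fiberwise univ ConjClasses.mk h]
  refine Finset.dvd_sum fun c _ => ?_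
  obtain ⟨y, rfl⟩ := ConjClasses.mk_surjective c
  have h1 : ∀ x ∈ univ.filter (fun x : G => ConjClasses.mk x = ConjClasses.mk y), h x = h y := by
    intro x hx
    simp only [mem_filter, mem_univ, true_and, ConjClasses.mk_eq_mk_iff_isConj] at hx
    exact hconj x y hx
  rw [Finset.sum_congr rfl h1, Finset.sum_const, smul_eq_mul]
  have h2 : #(univ.filter (fun x : G => ConjClasses.mk x = ConjClasses.mk y)) *
      Nat.card (Subgroup.centralizer {y}) = Nat.card G := by
    have h3 := MulAction.card_orbit_mul_card_stabilizer_eq_card_group (ConjAct G) y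
    have h4 := Subgroup.nat_card_centralizer_nat_card_stabilizer y
    rw [h4, ← Fintype.card_eq_nat_card, Nat.card_eq_fintype_card]
    rw [ConjAct.card] at h3
    rw [← h3]
    congr 1
    rw [← Set.toFinset_card]
    congr 1
    ext x
    simp [ConjAct.mem_orbit_conjAct, ConjClasses.mk_eq_mk_iff_isConj]
  rw [← h2, Nat.ordProj_mul]
  · exact mul_dvd_mul (Nat.ordProj_dvd _ _) (hdvd y)
  · intro h0; rw [h0, zero_mul] at h2; exact Nat.card_pos.ne' h2.symm
  · exact Nat.card_pos.ne'

open Finset in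
open scoped Classical in
theorem card_centralizer_qElements [Fintype G] (y : G) :
    Nat.card {u : Subgroup.centralizer {y} // ∃ k : ℕ, u ^ q ^ k = 1} =
      #(univ.filter fun u : G => Commute y u ∧ ∃ k : ℕ, u ^ q ^ k = 1) := by
  rw [← Fintype.card_subtype, Fintype.card_eq_nat_card]
  refine Nat.card_congr ⟨fun u => ⟨u.1.1, ?_, ?_⟩, fun u => ⟨⟨u.1, ?_⟩, ?_⟩,
    fun _ => rfl, fun _ => rfl⟩
  · exact (Subgroup.mem_centralizer_singleton_iff.1 u.1.2).symm
  · obtain ⟨k, hk⟩ := u.2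
    exact ⟨k, by simpa using congrArg Subtype.val hk⟩
  · exact Subgroup.mem_centralizer_singleton_iff.2 u.2.1.eq.symm
  · obtain ⟨k, hk⟩ := u.2.2
    exact ⟨k, Subtype.ext (by simpa using hk)⟩

open Finset in
open scoped Classical in
theorem card_commuting_qElements_conj [Fintype G] (x y : G) (h : IsConj x y) :
    #(univ.filter fun u : G => Commute x u ∧ ∃ k : ℕ, u ^ q ^ k = 1) =
      #(univ.filter fun u : G => Commute y u ∧ ∃ k : ℕ, u ^ q ^ k = 1) := by
  obtain ⟨c, rfl⟩ := isConj_iff.1 h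
  have fwd (c x u : G) (h : Commute x u ∧ ∃ k : ℕ, u ^ q ^ k = 1) :
      Commute (c * x * c⁻¹) (c * u * c⁻¹) ∧ ∃ k : ℕ, (c * u * c⁻¹) ^ q ^ k = 1 := by
    obtain ⟨h1, k, h2⟩ := h
    exact ⟨h1.map (MulAut.conj c), k, by rw [conj_pow, h2]; simp⟩
  refine Finset.card_bij' (fun u _ => c * u * c⁻¹) (fun u _ => c⁻¹ * u * c⁻¹⁻¹) ?_ ?_ ?_ ?_
  · simp only [mem_filter, mem_univ, true_and]
    exact fun u => fwd c x u
  · simp only [mem_filter, mem_univ, true_and]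
    intro u hu
    have := fwd c⁻¹ _ u hu
    rwa [show c⁻¹ * (c * x * c⁻¹) * c⁻¹⁻¹ = x by group] at this
  · intro u _; group
  · intro u _; group
end

open Finset in
open scoped Classical in
/-- **Frobenius' theorem** for prime powers. -/
theorem ordProj_dvd_card_qElements {q : ℕ} (hq : q.Prime) (n : ℕ) :
    ∀ (G : Type u) [Group G] [Finite G], Nat.card G = n →
    ordProj[q] (Nat.card G) ∣ Nat.card {u : G // ∃ k : ℕ, u ^ q ^ k = 1} := by
  induction n using Nat.strong_induction_on with | _ n ih =>
  intro G _ _ hG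
  have := Fintype.ofFinite G
  let N : G → ℕ := fun y => #(univ.filter fun u : G => Commute y u ∧ ∃ k : ℕ, u ^ q ^ k = 1)
  -- Count $G$ by $q'$-parts. Noncentral $y$ are handled by induction in $C(y)$; each central $y$
  -- contributes the number of all $q$-elements, which is the quantity sought.
  have key := sum_eq_sum_primeToPart (G := G) hq (fun _ => 1) (by simp)
  simp only [sum_const, smul_eq_mul, mul_one, one_mul, Finset.card_univ] at key
  rw [← Nat.card_eq_fintype_card] at key
  change Nat.card G = ∑ y ∈ univ.filter (fun y : G => ¬ q ∣ orderOf y), N y at key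
  rw [← Finset.sum_filter_add_sum_filter_not _ (fun y => y ∈ Subgroup.center G)] at key
  have h1 : ordProj[q] (Nat.card G) ∣
      ∑ y ∈ (univ.filter (fun y : G => ¬ q ∣ orderOf y)).filter (fun y => ¬ y ∈ Subgroup.center G),
        N y := by
    rw [Finset.filter_filter, Finset.sum_filter]
    apply ordProj_dvd_sum_of_class_function
    · intro x y hxy
      have e1 : orderOf x = orderOf y := by
        obtain ⟨c, rfl⟩ := isConj_iff.1 hxy
        exact (orderOf_injective (MulAut.conj c).toMonoidHom (MulAut.conj c).injective x).symm
      have e2 : x ∈ Subgroup.center G ↔ y ∈ Subgroup.center G := by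
        obtain ⟨c, rfl⟩ := isConj_iff.1 hxy
        have hc : (Subgroup.center G).Normal := inferInstance
        refine ⟨fun h => hc.conj_mem x h c, fun h => ?_⟩
        simpa [mul_assoc] using hc.conj_mem _ h c⁻¹
      simp only [e1, e2, N, card_commuting_qElements_conj x y hxy]
    · intro y
      split_ifs with hy
      · simp only [N]
        rw [← card_centralizer_qElements]
        refine ih _ ?_ _ rfl
        rw [← hG, lt_iff_le_and_ne]
        refine ⟨Subgroup.card_le_card_group _, fun h => hy.2 ?_⟩
        rw [Subgroup.card_eq_iff_eq_top, Subgroup.centralizer_eq_top_iff_subset] at h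
        exact h rfl
      · exact dvd_zero _
  have h2 : ordProj[q] (Nat.card G) ∣
      ∑ y ∈ (univ.filter (fun y : G => ¬ q ∣ orderOf y)).filter (fun y => y ∈ Subgroup.center G),
        N y := by
    rw [← Nat.dvd_add_left h1, ← key]
    exact Nat.ordProj_dvd _ _
  have h3 : ∀ y ∈ (univ.filter (fun y : G => ¬ q ∣ orderOf y)).filter
      (fun y => y ∈ Subgroup.center G), N y = Nat.card {u : G // ∃ k : ℕ, u ^ q ^ k = 1} := by
    intro y hy
    have hy2 := (Finset.mem_filter.1 hy).2
    rw [Nat.card_eq_fintype_card, Fintype.card_subtype]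
    simp only [N]
    congr 1
    ext u
    simp only [mem_filter, mem_univ, true_and, and_iff_right_iff_imp]
    exact fun _ => ((Subgroup.mem_center_iff.1 hy2) u).symm
  rw [Finset.sum_congr rfl h3, Finset.sum_const, smul_eq_mul] at h2
  refine Nat.Coprime.dvd_of_dvd_mul_left ?_ h2
  refine Nat.Coprime.pow_left _ ((Nat.Prime.coprime_iff_not_dvd hq).2 fun h4 => ?_)
  -- The central $q'$-elements form a subgroup without elements of order $q$, so by Cauchy their
  -- number is prime to $q$ and can be cancelled.
  let K : Subgroup G :=
    { carrier := {z | ¬ q ∣ orderOf z ∧ z ∈ Subgroup.center G}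
      one_mem' := ⟨by simpa using hq.one_lt.ne', one_mem _⟩
      mul_mem' := fun {a b} ha hb => by
        refine ⟨?_, mul_mem ha.2 hb.2⟩
        have ha1 := (pow_ordCompl_eq_one_iff hq a).2 ha.1
        have hb1 := (pow_ordCompl_eq_one_iff hq b).2 hb.1
        rw [← pow_ordCompl_eq_one_iff hq,
          Commute.mul_pow ((Subgroup.mem_center_iff.1 hb.2) a), ha1, hb1, one_mul]
      inv_mem' := fun {a} ha => ⟨by rw [orderOf_inv]; exact ha.1, inv_mem ha.2⟩ }
  have hK : #((univ.filter (fun y : G => ¬ q ∣ orderOf y)).filter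
      (fun y => y ∈ Subgroup.center G)) = Nat.card K := by
    rw [Finset.filter_filter, ← Fintype.card_subtype, Fintype.card_eq_nat_card]
    rfl
  rw [hK] at h4
  have := Fact.mk hq
  obtain ⟨z, hz⟩ := exists_prime_orderOf_dvd_card' q h4
  apply z.2.1
  rw [Subgroup.orderOf_coe, hz]

/-! ### Divisibility of the exponents, and the order of $G$ -/

/-- The exponent of `p` in the product of the element orders of `G`. -/
noncomputable def orderExp (p : ℕ) (G : Type*) [Group G] [Finite G] : ℕ :=
  ∑ᶠ g : G, (orderOf g).factorization p

theorem orderExp_eq_sum (p : ℕ) (G : Type*) [Group G] [Fintype G] :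
    orderExp p G = ∑ g : G, (orderOf g).factorization p :=
  finsum_eq_sum_of_fintype _

open scoped Classical in
-- For $q\ne p$ the $q$-part of an element does not affect the $p$-adic valuation of its order. So
-- the sum runs over $q'$-elements $y$, weighted by the number of $q$-elements of $C(y)$, to which
-- Frobenius applies.
theorem ordProj_dvd_orderExp {p q : ℕ} (hq : q.Prime) (hpq : p ≠ q) (G : Type*) [Group G]
    [Finite G] : ordProj[q] (Nat.card G) ∣ orderExp p G := by
  have := Fintype.ofFinite G
  rw [orderExp_eq_sum, sum_eq_sum_primeToPart hq, Finset.sum_filter]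
  · apply ordProj_dvd_sum_of_class_function
    · intro x y hxy
      have e1 : orderOf x = orderOf y := by
        obtain ⟨c, rfl⟩ := isConj_iff.1 hxy
        exact (orderOf_injective (MulAut.conj c).toMonoidHom (MulAut.conj c).injective x).symm
      simp only [e1, card_commuting_qElements_conj x y hxy]
    · intro y
      by_cases hy : q ∣ orderOf y
      · rw [if_neg (not_not.2 hy)]
        exact dvd_zero _
      · rw [if_pos hy, ← card_centralizer_qElements]
        exact (ordProj_dvd_card_qElements hq _ _ rfl).mul_left _
  · rintro y u hc hy ⟨k, hk⟩
    obtain ⟨j, -, hj⟩ := (Nat.dvd_prime_pow hq).1 (orderOf_dvd_of_pow_eq_one hk)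
    have hco : (orderOf y).Coprime (orderOf u) := by
      rw [hj]
      exact ((Nat.Prime.coprime_iff_not_dvd hq).2 hy).symm.pow_right _
    rw [hc.orderOf_mul_eq_mul_orderOf_of_coprime hco,
      Nat.factorization_mul (orderOf_pos y).ne' (orderOf_pos u).ne', hj, hq.factorization_pow]
    simp [hpq]

theorem dvd_orderExp {p m : ℕ} (G : Type*) [Group G] [Finite G] (hm : m ∣ Nat.card G)
    (hpm : ¬ p ∣ m) : m ∣ orderExp p G := by
  have hn : Nat.card G ≠ 0 := Nat.card_pos.ne'
  have hm0 : m ≠ 0 := ne_zero_of_dvd_ne_zero hn hm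
  rcases eq_or_ne (orderExp p G) 0 with h0 | h0
  · rw [h0]; exact dvd_zero _
  rw [← Nat.factorization_le_iff_dvd hm0 h0]
  intro q
  by_cases hq : q.Prime
  · by_cases hqm : q ∣ m
    · have hpq : p ≠ q := by rintro rfl; exact hpm hqm
      exact ((Nat.factorization_le_iff_dvd hm0 hn).2 hm q).trans
        ((hq.pow_dvd_iff_le_factorization h0).1 (ordProj_dvd_orderExp hq hpq G))
    · simp [Nat.factorization_eq_zero_of_not_dvd hqm]
  · simp [Nat.factorization_eq_zero_of_not_prime _ hq]

open scoped Classical in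
-- Inversion preserves orders, and its fixed points satisfy $g^2=1$, so they contribute $0$ when $p$
-- is odd.
theorem even_orderExp {p : ℕ} (hp : p.Prime) (hp2 : p ≠ 2) (G : Type*) [Group G] [Finite G] :
    Even (orderExp p G) := by
  have := Fintype.ofFinite G
  rw [orderExp_eq_sum, ← ZMod.natCast_eq_zero_iff_even, Nat.cast_sum]
  refine Finset.sum_involution (fun g _ => g⁻¹) ?_ ?_ ?_ ?_
  · intro g _
    rw [orderOf_inv, CharTwo.add_self_eq_zero]
  · intro g _ hg h
    apply hg
    have h2 : g ^ 2 = 1 := by rw [pow_two]; nth_rewrite 1 [← h]; exact inv_mul_cancel g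
    rw [Nat.factorization_eq_zero_of_not_dvd, Nat.cast_zero]
    intro h3
    exact hp2 ((Nat.prime_dvd_prime_iff_eq hp Nat.prime_two).1
      (h3.trans (orderOf_dvd_of_pow_eq_one h2)))
  · simp
  · simp

theorem factorization_rhoProd (p : ℕ) (G : Type*) [Group G] [Finite G] :
    (rhoProd G).factorization p = orderExp p G := by
  have := Fintype.ofFinite G
  rw [rhoProd, finprod_eq_prod_of_fintype, orderExp_eq_sum, Nat.factorization_prod]
  · simp
  · exact fun g _ => (orderOf_pos g).ne'

theorem mem_ExpRho_iff (G : Type*) [Group G] [Finite G] (a : ℕ) :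
    a ∈ ExpRho G ↔ ∃ p : ℕ, p.Prime ∧ p ∣ Nat.card G ∧ orderExp p G = a := by
  have := Fintype.ofFinite G
  have key (p : ℕ) (hp : p.Prime) : p ∣ rhoProd G ↔ p ∣ Nat.card G := by
    rw [rhoProd, finprod_eq_prod_of_fintype, hp.prime.dvd_finsetProd_iff]
    constructor
    · rintro ⟨g, -, hg⟩
      exact hg.trans (orderOf_dvd_natCard g)
    · intro h
      have := Fact.mk hp
      obtain ⟨g, hg⟩ := exists_prime_orderOf_dvd_card' p h
      exact ⟨g, Finset.mem_univ _, hg ▸ dvd_rfl⟩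
  simp only [ExpRho, expSet, Set.mem_ofPred_eq, factorization_rhoProd]
  exact exists_congr fun p => and_congr_right fun hp => and_congr_left fun _ => key p hp

theorem orderExp_congr (p : ℕ) {G H : Type*} [Group G] [Finite G] [Group H] [Finite H]
    (e : G ≃* H) : orderExp p G = orderExp p H :=
  finsum_eq_of_bijective e e.bijective fun g => by rw [MulEquiv.orderOf_eq]

theorem ExpRho_congr {G H : Type*} [Group G] [Finite G] [Group H] [Finite H]
    (e : G ≃* H) : ExpRho G = ExpRho H := by
  ext a
  simp only [mem_ExpRho_iff, orderExp_congr _ e, Nat.card_congr e.toEquiv]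

theorem card_of_ExpRho_eq {G : Type*} [Group G] [Finite G]
    (h : ExpRho G = {168, 273, 364, 468}) :
    (Nat.card G = 546 ∨ Nat.card G = 1092) ∧ orderExp 2 G = 273 ∧ orderExp 3 G = 364 ∧
      orderExp 7 G = 468 ∧ orderExp 13 G = 168 := by
  have hn : Nat.card G ≠ 0 := Nat.card_pos.ne'
  have key (a : ℕ) (ha : a ∈ ({168, 273, 364, 468} : Set ℕ)) :
      ∃ p : ℕ, p.Prime ∧ p ∣ Nat.card G ∧ orderExp p G = a := by
    rw [← mem_ExpRho_iff, h]; exact ha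
  obtain ⟨p, hp, hpn, hpa⟩ := key 273 (by simp)
  -- 273 is the only odd value, so it belongs to the prime 2, and the odd part of $|G|$ divides
  -- $273=3\cdot7\cdot13$.
  obtain rfl : p = 2 := by
    by_contra h2
    have := even_orderExp hp h2 G
    rw [hpa] at this
    exact absurd this (by decide)
  have hm : ordCompl[2] (Nat.card G) ∣ 273 := by
    rw [← hpa]
    exact dvd_orderExp G (Nat.ordCompl_dvd _ _) (Nat.not_dvd_ordCompl hp hn)
  have hpr (p : ℕ) (hp : p.Prime) (hpn : p ∣ Nat.card G) : p = 2 ∨ p = 3 ∨ p = 7 ∨ p = 13 := by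
    rw [← Nat.ordProj_mul_ordCompl_eq_self (Nat.card G) 2] at hpn
    rcases (Nat.Prime.dvd_mul hp).1 hpn with h1 | h1
    · left
      exact (Nat.prime_dvd_prime_iff_eq hp Nat.prime_two).1 (hp.dvd_of_dvd_pow h1)
    · right
      have h2 : p ∣ 3 * (7 * 13) := h1.trans hm
      rw [hp.dvd_mul, hp.dvd_mul, Nat.prime_dvd_prime_iff_eq hp (by norm_num),
        Nat.prime_dvd_prime_iff_eq hp (by norm_num),
        Nat.prime_dvd_prime_iff_eq hp (by norm_num)] at h2
      exact h2
  obtain ⟨p₁, hp₁, hn₁, h₁⟩ := key 168 (by simp)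
  obtain ⟨p₂, hp₂, hn₂, h₂⟩ := key 364 (by simp)
  obtain ⟨p₃, hp₃, hn₃, h₃⟩ := key 468 (by simp)
  -- The three remaining values are distinct, so they need three distinct odd primes; divisibility
  -- by 91, 39 and 21 then decides which value goes with which prime.
  have hdvd : 3 ∣ Nat.card G ∧ 7 ∣ Nat.card G ∧ 13 ∣ Nat.card G := by
    rcases hpr p₁ hp₁ hn₁ with rfl | rfl | rfl | rfl <;>
    rcases hpr p₂ hp₂ hn₂ with rfl | rfl | rfl | rfl <;>
    rcases hpr p₃ hp₃ hn₃ with rfl | rfl | rfl | rfl <;>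
    first | exact ⟨by assumption, by assumption, by assumption⟩ | (exfalso; omega)
  obtain ⟨d3, d7, d13⟩ := hdvd
  have e3 : 91 ∣ orderExp 3 G := dvd_orderExp G (by omega) (by norm_num)
  have e7 : 39 ∣ orderExp 7 G := dvd_orderExp G (by omega) (by norm_num)
  have e13 : 21 ∣ orderExp 13 G := dvd_orderExp G (by omega) (by norm_num)
  have hval : orderExp 3 G = 364 ∧ orderExp 7 G = 468 ∧ orderExp 13 G = 168 := by
    rcases hpr p₁ hp₁ hn₁ with rfl | rfl | rfl | rfl <;>
    rcases hpr p₂ hp₂ hn₂ with rfl | rfl | rfl | rfl <;>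
    rcases hpr p₃ hp₃ hn₃ with rfl | rfl | rfl | rfl <;>
    omega
  refine ⟨?_, hpa, hval⟩
  -- $8\cdot 91=728$ does not divide $e_3=364$.
  have h8 : ¬ 8 ∣ Nat.card G := fun h8 => by
    have : 728 ∣ orderExp 3 G := dvd_orderExp G (by omega) (by norm_num)
    omega
  have hmn := Nat.ordProj_mul_ordCompl_eq_self (Nat.card G) 2
  have h273 : ordCompl[2] (Nat.card G) = 273 := by
    refine Nat.dvd_antisymm hm ?_
    have : 273 ∣ Nat.card G := by omega
    rw [← hmn] at this
    exact (Nat.Coprime.pow_right _ (by norm_num)).dvd_of_dvd_mul_left this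
  rw [h273] at hmn
  have hle : (Nat.card G).factorization 2 < 3 := by
    by_contra! hge
    apply h8
    rw [show 8 = 2 ^ 3 by norm_num, hp.pow_dvd_iff_le_factorization hn]
    exact hge
  interval_cases (Nat.card G).factorization 2 <;> omega

/-! ### Sylow subgroups of prime order -/

section
variable {G : Type*} [Group G] [Finite G] {p : ℕ} [hp : Fact p.Prime]

omit [Finite G] hp in
theorem Sylow.mem_of_commute (Q : Sylow p G) {x : G} {k : ℕ} (hx : x ^ p ^ k = 1)
    (hc : x ∈ Subgroup.centralizer (Q : Set G)) : x ∈ Q := by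
  have h1 : IsPGroup p (Subgroup.zpowers x) := by
    rintro ⟨y, hy⟩
    obtain ⟨j, rfl⟩ := Subgroup.mem_zpowers_iff.1 hy
    refine ⟨k, Subtype.ext ?_⟩
    simp only [Subgroup.coe_pow, Subgroup.coe_one]
    rw [← zpow_natCast, zpow_comm, zpow_natCast, hx, one_zpow]
  have h2 := h1.inf_normalizer_sylow Q
  have h3 : x ∈ Subgroup.zpowers x ⊓ Subgroup.normalizer (Q : Set G) :=
    ⟨Subgroup.mem_zpowers x, Subgroup.centralizer_le_normalizer _ hc⟩
  rw [h2] at h3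
  exact h3.2

theorem Sylow.card_eq_of_card_eq {P : Sylow p G} {n : ℕ} (h : Nat.card P = n) (Q : Sylow p G) :
    Nat.card Q = n := by
  rw [Q.card_eq_multiplicity, ← P.card_eq_multiplicity, h]

theorem Sylow.card_centralizer_eq (P Q : Sylow p G) :
    Nat.card (Subgroup.centralizer (Q : Set G)) = Nat.card (Subgroup.centralizer (P : Set G)) := by
  obtain ⟨g, rfl⟩ := MulAction.exists_smul_eq G P Q
  refine (Nat.card_congr (Equiv.subtypeEquiv (MulAut.conj g).toEquiv fun a => ?_)).symm
  simp only [Subgroup.mem_centralizer_iff, SetLike.mem_coe]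
  constructor
  · intro h y hy
    obtain ⟨x, hx, rfl⟩ : ∃ x ∈ P, MulAut.conj g x = y := hy
    exact (Commute.map (h x hx : Commute x a) (MulAut.conj g)).eq
  · intro h x hx
    have := h (MulAut.conj g x) ⟨x, hx, rfl⟩
    apply (MulAut.conj g).injective
    simpa using this

open Finset in
open scoped Classical in
-- Multiplication identifies $Q\times\{p'\text{-elements of }C(Q)\}$ with $C(Q)$: the $p$-part of an
-- element centralizing the Sylow subgroup $Q$ lies in $Q$.
theorem card_centralizer_primeTo [Fintype G] (Q : Sylow p G) (hQ : Nat.card Q = p) :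
    p * #(univ.filter fun g : G => g ∈ Subgroup.centralizer (Q : Set G) ∧ ¬ p ∣ orderOf g) =
      Nat.card (Subgroup.centralizer (Q : Set G)) := by
  have hn : Nat.card G ≠ 0 := Nat.card_pos.ne'
  have hc : (ordProj[p] (Nat.card G)).Coprime (ordCompl[p] (Nat.card G)) :=
    (Nat.coprime_ordCompl hp.out hn).pow_left _
  have hmul := Nat.ordProj_mul_ordCompl_eq_self (Nat.card G) p
  have hprojp : ordProj[p] (Nat.card G) = p := by rw [← Q.card_eq_multiplicity, hQ]
  obtain ⟨e, f, he0, hf0, he1, hf1, hef⟩ := Nat.exists_split_idempotents hc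
  rw [hmul] at hef
  have hcard (g : G) : g ^ Nat.card G = 1 := pow_card_eq_one'
  have hself : ∀ w ∈ Q, w ∈ Subgroup.centralizer (Q : Set G) := by
    have : IsMulCommutative Q := by
      have := isCyclic_of_prime_card hQ
      infer_instance
    exact Subgroup.le_centralizer (Q : Subgroup G)
  have hwp : ∀ w ∈ Q, w ^ ordProj[p] (Nat.card G) = 1 := by
    intro w hw
    rw [hprojp, ← hQ]
    exact orderOf_dvd_iff_pow_eq_one.1 (Subgroup.orderOf_dvd_natCard (Q : Subgroup G) hw)
  rw [← Fintype.card_subtype, Fintype.card_eq_nat_card]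
  nth_rewrite 1 [← hQ]
  rw [← Nat.card_prod]
  refine Nat.card_congr
    { toFun := fun x => ⟨x.1.1 * x.2.1, mul_mem (hself _ x.1.2) x.2.2.1⟩
      invFun := fun g => ⟨⟨g.1 ^ f, ?_⟩, ⟨g.1 ^ e, pow_mem g.2 e, ?_⟩⟩
      left_inv := ?_
      right_inv := ?_ }
  · refine Q.mem_of_commute (k := (Nat.card G).factorization p) ?_ (pow_mem g.2 f)
    rw [← pow_mul, mul_comm]
    exact pow_eq_one_of_dvd_of_pow_eq_one (hcard _) (hmul.symm.dvd.trans (mul_dvd_mul_left _ hf0))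
  · rw [← pow_ordCompl_eq_one_iff hp.out, ← pow_mul]
    exact pow_eq_one_of_dvd_of_pow_eq_one (hcard _) (hmul.symm.dvd.trans (mul_dvd_mul_right he0 _))
  · rintro ⟨⟨w, hw⟩, ⟨g, hg, hpg⟩⟩
    have hcomm : Commute w g := hg w hw
    have hgm := (pow_ordCompl_eq_one_iff hp.out g).2 hpg
    simp only [hcomm.mul_pow, pow_eq_self_of_modEq_one (hwp w hw) hf1,
      pow_eq_one_of_dvd_of_pow_eq_one hgm hf0, pow_eq_self_of_modEq_one hgm he1,
      pow_eq_one_of_dvd_of_pow_eq_one (hwp w hw) he0, mul_one, one_mul]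
  · rintro ⟨g, hg⟩
    apply Subtype.ext
    simp only
    rw [← pow_add, add_comm]
    exact pow_eq_self_of_modEq_one (hcard g) hef

theorem orderExp_eq_card (hG : (Nat.card G).factorization p = 1) :
    orderExp p G = Nat.card {g : G // p ∣ orderOf g} := by
  classical
  have := Fintype.ofFinite G
  rw [orderExp_eq_sum, Nat.card_eq_fintype_card, Fintype.card_subtype, Finset.card_filter]
  refine Finset.sum_congr rfl fun g _ => ?_
  have h1 : (orderOf g).factorization p ≤ 1 := by
    rw [← hG]
    exact (Nat.factorization_le_iff_dvd (orderOf_pos g).ne' Nat.card_pos.ne').2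
      (orderOf_dvd_natCard g) p
  split_ifs with h
  · have := hp.out.factorization_pos_of_dvd (orderOf_pos g).ne' h
    omega
  · exact Nat.factorization_eq_zero_of_not_dvd h

open Finset in
-- Double counting of pairs $(g,Q)$ with $p\mid o(g)$ and $g\in C(Q)$. Each such $g$ centralizes
-- exactly one Sylow subgroup, and a proportion $(p-1)/p$ of each $C(Q)$ has order divisible by $p$.
theorem orderExp_mul_prime (P : Sylow p G) (hP : Nat.card P = p) :
    orderExp p G * p =
      Nat.card (Sylow p G) * ((p - 1) * Nat.card (Subgroup.centralizer (P : Set G))) := by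
  classical
  have := Fintype.ofFinite G
  have := Fintype.ofFinite (Sylow p G)
  have hf : (Nat.card G).factorization p = 1 := by
    have := P.card_eq_multiplicity
    rw [hP] at this
    exact (Nat.pow_right_injective hp.out.two_le (by simpa using this)).symm
  rw [orderExp_eq_card hf, Nat.card_eq_fintype_card, Fintype.card_subtype]
  have hcount := Finset.sum_card_bipartiteAbove_eq_sum_card_bipartiteBelow
    (s := univ.filter fun g : G => p ∣ orderOf g) (t := (univ : Finset (Sylow p G)))
    (fun g (Q : Sylow p G) => g ∈ Subgroup.centralizer (Q : Set G))
  have h1 : ∀ g ∈ univ.filter (fun g : G => p ∣ orderOf g),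
      #(bipartiteAbove (fun g (Q : Sylow p G) => g ∈ Subgroup.centralizer (Q : Set G)) univ g) = 1 := by
    intro g hg
    simp only [mem_filter, mem_univ, true_and] at hg
    -- The only Sylow subgroup centralized by $g$ is the one generated by this power of $g$.
    have hx : orderOf (g ^ (orderOf g / p)) = p := orderOf_pow_orderOf_div (orderOf_pos g).ne' hg
    set x := g ^ (orderOf g / p)
    have hxp : x ^ p ^ 1 = 1 := by rw [pow_one, ← hx]; exact pow_orderOf_eq_one x
    have hxcard : Nat.card (Subgroup.zpowers x) = p := by rw [Nat.card_zpowers, hx]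
    have heq (Q : Sylow p G) (hxQ : x ∈ Q) : (Q : Subgroup G) = Subgroup.zpowers x :=
      (Subgroup.eq_of_le_of_card_ge (Subgroup.zpowers_le.2 hxQ)
        (by rw [hxcard]; exact (Sylow.card_eq_of_card_eq hP Q).le)).symm
    have hpg : IsPGroup p (Subgroup.zpowers x) := IsPGroup.of_card (n := 1) (by simpa using hxcard)
    obtain ⟨Q, hQ⟩ := hpg.exists_le_sylow
    have hxQ : x ∈ Q := hQ (Subgroup.mem_zpowers x)
    rw [Finset.card_eq_one]
    refine ⟨Q, ?_⟩
    ext R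
    simp only [mem_bipartiteAbove, mem_univ, true_and, mem_singleton]
    constructor
    · intro hR
      have hxR : x ∈ R := R.mem_of_commute hxp (pow_mem hR _)
      exact Sylow.ext ((heq R hxR).trans (heq Q hxQ).symm)
    · rintro rfl
      rw [Subgroup.mem_centralizer_iff]
      intro y hy
      have hy' : y ∈ (R : Subgroup G) := hy
      rw [heq R hxQ] at hy'
      obtain ⟨j, rfl⟩ := Subgroup.mem_zpowers_iff.1 hy'
      exact ((Commute.refl g).pow_left _).zpow_left j
  rw [Finset.sum_congr rfl h1, Finset.sum_const, smul_eq_mul, mul_one] at hcount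
  rw [hcount, Finset.sum_mul]
  have h2 : ∀ Q ∈ (univ : Finset (Sylow p G)),
      #(bipartiteBelow (fun g (Q : Sylow p G) => g ∈ Subgroup.centralizer (Q : Set G))
        (univ.filter fun g : G => p ∣ orderOf g) Q) * p =
      (p - 1) * Nat.card (Subgroup.centralizer (P : Set G)) := by
    intro Q _
    have h3 := card_centralizer_primeTo Q (Sylow.card_eq_of_card_eq hP Q)
    rw [Sylow.card_centralizer_eq P Q] at h3
    have h4 : #(univ.filter fun g : G => g ∈ Subgroup.centralizer (Q : Set G)) =
        Nat.card (Subgroup.centralizer (P : Set G)) := by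
      rw [← Sylow.card_centralizer_eq P Q, ← Fintype.card_subtype, Fintype.card_eq_nat_card]
    have h5 := Finset.card_filter_add_card_filter_not
      (s := univ.filter fun g : G => g ∈ Subgroup.centralizer (Q : Set G)) (fun g => p ∣ orderOf g)
    rw [h4, Finset.filter_filter, Finset.filter_filter] at h5
    rw [bipartiteBelow, Finset.filter_filter]
    simp only [and_comm (a := p ∣ orderOf _)]
    set A := #(univ.filter fun g : G => g ∈ Subgroup.centralizer (Q : Set G) ∧ p ∣ orderOf g)
    set B := #(univ.filter fun g : G => g ∈ Subgroup.centralizer (Q : Set G) ∧ ¬ p ∣ orderOf g)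
    obtain ⟨r, rfl⟩ : ∃ r, p = r + 1 := ⟨p - 1, by have := hp.out.pos; omega⟩
    rw [← h3, Nat.add_sub_cancel]
    have : A = r * B := by linarith
    rw [this]; ring
  rw [Finset.sum_congr rfl h2, Finset.sum_const, smul_eq_mul, Finset.card_univ,
    Nat.card_eq_fintype_card (α := Sylow p G)]
end

/-! ### Groups of order 546 -/

/-- The homomorphism from `ZMod n` sending `a` to `z ^ a`, for `z ^ n = 1`. -/
def zmodPowHom {G : Type*} [Group G] (n : ℕ) [NeZero n] (z : G) (hz : z ^ n = 1) :
    Multiplicative (ZMod n) →* G where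
  toFun a := z ^ a.toAdd.val
  map_one' := by simp
  map_mul' a b := by
    rw [← pow_add, toAdd_mul, ZMod.val_add, ← pow_eq_pow_mod _ hz]

theorem zmodPowHom_apply {G : Type*} [Group G] (n : ℕ) [NeZero n] (z : G) (hz : z ^ n = 1)
    (a : Multiplicative (ZMod n)) : zmodPowHom n z hz a = z ^ a.toAdd.val := rfl

theorem conj_pow_eq_pow_pow {G : Type*} [Group G] {x y : G} {r : ℕ} (h : y * x * y⁻¹ = x ^ r)
    (j : ℕ) : y ^ j * x * (y ^ j)⁻¹ = x ^ r ^ j := by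
  induction j with
  | zero => simp
  | succ j ih =>
    calc y ^ (j + 1) * x * (y ^ (j + 1))⁻¹ = y * (y ^ j * x * (y ^ j)⁻¹) * y⁻¹ := by
          rw [pow_succ']; group
      _ = x ^ r ^ (j + 1) := by rw [ih, ← conj_pow, h, ← pow_mul, pow_succ']

theorem nonempty_mulEquiv_Z14Z13Z3 {G : Type*} [Group G] [Finite G] (hG : Nat.card G = 546)
    {z x y : G} (hz : orderOf z = 14) (hx : orderOf x = 13) (hy : orderOf y = 3)
    (hzx : Commute z x) (hzy : Commute z y) (hyx : y * x * y⁻¹ = x ^ 3) :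
    Nonempty (G ≃* Z14Z13Z3) := by
  have hx13 : x ^ 13 = 1 := by rw [← hx]; exact pow_orderOf_eq_one x
  have hy3 : y ^ 3 = 1 := by rw [← hy]; exact pow_orderOf_eq_one y
  have hz14 : z ^ 14 = 1 := by rw [← hz]; exact pow_orderOf_eq_one z
  let f : Z13Z3 →* G := SemidirectProduct.lift (zmodPowHom 13 x hx13) (zmodPowHom 3 y hy3) (by
    intro g
    refine MonoidHom.ext fun (a : Multiplicative (ZMod 13)) => ?_
    change x ^ ((3 : ZMod 13) ^ g.toAdd.val * a.toAdd).val =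
      y ^ g.toAdd.val * x ^ a.toAdd.val * (y ^ g.toAdd.val)⁻¹
    rw [← conj_pow, conj_pow_eq_pow_pow hyx, ← pow_mul, pow_eq_pow_iff_modEq, hx,
      ← ZMod.natCast_eq_natCast_iff]
    simp)
  have hf (a : Z13Z3) : f a = x ^ a.left.toAdd.val * y ^ a.right.toAdd.val := rfl
  let F : Z14Z13Z3 →* G := MonoidHom.noncommCoprod (zmodPowHom 14 z hz14) f (by
    intro a b
    rw [zmodPowHom_apply, hf]
    exact ((hzx.pow_pow _ _).mul_right (hzy.pow_pow _ _)))
  have hF (a : Z14Z13Z3) : F a = z ^ a.1.toAdd.val * f a.2 := rfl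
  have hcard : Nat.card Z14Z13Z3 = 546 := by
    rw [Nat.card_prod, SemidirectProduct.card]
    simp [Nat.card_eq_fintype_card, ZMod.card]
  have : Finite Z14Z13Z3 := Nat.finite_of_card_ne_zero (by rw [hcard]; norm_num)
  have hmem (g : G) (hg : g ∈ F.range) : orderOf g ∣ Nat.card F.range :=
    Subgroup.orderOf_dvd_natCard _ hg
  have h1 := hmem z ⟨(Multiplicative.ofAdd 1, 1), by
    rw [hF]; simp [show (1 : ZMod 14).val = 1 from rfl]⟩
  have h2 := hmem x ⟨(1, SemidirectProduct.inl (Multiplicative.ofAdd 1)), by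
    rw [hF, hf]; simp [show (1 : ZMod 13).val = 1 from rfl]⟩
  have h3 := hmem y ⟨(1, SemidirectProduct.inr (Multiplicative.ofAdd 1)), by
    rw [hF, hf]; simp [show (1 : ZMod 3).val = 1 from rfl]⟩
  rw [hz] at h1; rw [hx] at h2; rw [hy] at h3
  have h4 : F.range = ⊤ := by
    -- The order of the range is divisible by 14, 13 and 3, hence by 546.
    apply Subgroup.eq_top_of_le_card
    rw [hG]
    exact Nat.le_of_dvd Nat.card_pos (by omega)
  exact ⟨(MulEquiv.ofBijective F ((Nat.bijective_iff_surjective_and_card F).2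
    ⟨MonoidHom.range_eq_top.1 h4, by rw [hcard, hG]⟩)).symm⟩

theorem Sylow.card_eq_prime {G : Type*} [Group G] [Finite G] {p m : ℕ} [hp : Fact p.Prime]
    (P : Sylow p G) (h : Nat.card G = p * m) (hm : ¬ p ∣ m) : Nat.card P = p := by
  have hm0 : m ≠ 0 := fun h0 => hm (h0 ▸ dvd_zero p)
  rw [P.card_eq_multiplicity, h, Nat.factorization_mul hp.out.ne_zero hm0]
  simp [hp.out.factorization_self, Nat.factorization_eq_zero_of_not_dvd hm]

/-- The value $(p-1)m$ amounts to $n_p|C(P)|=|G|=n_p|N(P)|$, so $C(P)=N(P)$. By Burnside, the kernel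
of the transfer to $P$ has order prime to $p$, and it contains $G'$ because $P$ is abelian. -/
theorem not_dvd_card_commutator {G : Type*} [Group G] [Finite G] {p m : ℕ} [hp : Fact p.Prime]
    (h : Nat.card G = p * m) (hm : ¬ p ∣ m) (hexp : orderExp p G = (p - 1) * m) :
    ¬ p ∣ Nat.card (commutator G) := by
  let P : Sylow p G := default
  have hP := P.card_eq_prime h hm
  have h1 := orderExp_mul_prime P hP
  have hp1 : 0 < p - 1 := by have := hp.out.two_le; omega
  have h2 : Nat.card (Sylow p G) * Nat.card (Subgroup.centralizer (P : Set G)) = Nat.card G := by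
    apply Nat.eq_of_mul_eq_mul_left hp1
    rw [h]
    calc _ = orderExp p G * p := by rw [h1]; ring
      _ = _ := by rw [hexp]; ring
  have h3 := (Subgroup.normalizer (P : Set G)).index_mul_card
  rw [← P.card_eq_index_normalizer, ← h2] at h3
  have h4 := Nat.eq_of_mul_eq_mul_left Nat.card_pos h3
  have h5 : Subgroup.centralizer (P : Set G) = Subgroup.normalizer (P : Set G) :=
    Subgroup.eq_of_le_of_card_ge (Subgroup.centralizer_le_normalizer _) h4.le
  have : IsMulCommutative P := by
    have := isCyclic_of_prime_card hP
    infer_instance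
  intro h6
  have h7 := MonoidHom.not_dvd_card_ker_transferSylow P h5.ge
  refine h7 (h6.trans (Subgroup.card_dvd_of_le ?_))
  rw [commutator_def, Subgroup.commutator_le]
  intro a _ b _
  rw [MonoidHom.mem_ker, map_commutatorElement, commutatorElement_eq_one_iff_commute]
  exact Std.Commutative.comm (op := ((· * ·) : P → P → P)) _ _

/-- Such an $s$ is 3 or 9. The exponents are those for which $h^j$ has order 3 when $h$ has order
42. -/
theorem exists_pow_eq_three : ∀ s : ZMod 13, s ^ 3 = 1 → s ≠ 1 →
    ∃ j ∈ ({14, 28} : Finset ℕ), s ^ j = 3 := by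
  decide +kernel

theorem exists_generators_of_card_546 {G : Type*} [Group G] [Finite G] (hG : Nat.card G = 546)
    (h2 : orderExp 2 G = 273) (h3 : orderExp 3 G = 364) (h7 : orderExp 7 G = 468)
    (h13 : orderExp 13 G = 168) : ∃ z x y : G, orderOf z = 14 ∧ orderOf x = 13 ∧ orderOf y = 3 ∧
      Commute z x ∧ Commute z y ∧ y * x * y⁻¹ = x ^ 3 := by
  have := Fact.mk Nat.prime_two
  have := Fact.mk Nat.prime_three
  have : Fact (Nat.Prime 7) := ⟨by norm_num⟩
  have : Fact (Nat.Prime 13) := ⟨by norm_num⟩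
  have k2 := not_dvd_card_commutator (p := 2) (m := 273) hG (by norm_num) h2
  have k3 := not_dvd_card_commutator (p := 3) (m := 182) hG (by norm_num) h3
  have k7 := not_dvd_card_commutator (p := 7) (m := 78) hG (by norm_num) h7
  have hK1 : Nat.card (commutator G) ∣ 13 := by
    have h := Subgroup.card_subgroup_dvd_card (commutator G)
    rw [hG, show 546 = 2 * (3 * (7 * 13)) by norm_num] at h
    have c2 := (Nat.Prime.coprime_iff_not_dvd Nat.prime_two).2 k2
    have c3 := (Nat.Prime.coprime_iff_not_dvd Nat.prime_three).2 k3
    have c7 := (Nat.Prime.coprime_iff_not_dvd (by norm_num : Nat.Prime 7)).2 k7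
    exact c7.symm.dvd_of_dvd_mul_left (c3.symm.dvd_of_dvd_mul_left (c2.symm.dvd_of_dvd_mul_left h))
  have hcomm13 : Nat.card (commutator G) = 13 := by
    rcases (Nat.dvd_prime (by norm_num)).1 hK1 with h | h
    -- An abelian group of order 546 would have $e_{13}=12\cdot 42=504$.
    · exfalso
      let P : Sylow 13 G := default
      have hB := orderExp_mul_prime P (P.card_eq_prime (m := 42) hG (by norm_num))
      have hc : Subgroup.centralizer (P : Set G) = ⊤ := by
        rw [Subgroup.card_eq_one, commutator_def, Subgroup.commutator_eq_bot_iff_le_centralizer] at h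
        exact top_le_iff.1 (h.trans (Subgroup.centralizer_le (Set.subset_univ _)))
      rw [hc, Subgroup.card_top, hG, h13] at hB
      omega
    · exact h
  have hidx := (commutator G).index_mul_card
  rw [hcomm13, hG] at hidx
  have hidx' : (commutator G).index = 42 := by omega
  obtain ⟨H, hH⟩ := Subgroup.exists_right_complement'_of_coprime (N := commutator G)
    (by rw [hcomm13, hidx']; norm_num)
  have hHcard : Nat.card H = 42 := by
    rw [← hH.symm.index_eq_card, hidx']
  have hZ : IsZGroup G := IsZGroup.of_squarefree (by
    rw [hG]; decide +kernel)
  -- The complement embeds in the abelianization, which is cyclic because all Sylow subgroups of $G$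
  -- are.
  have hHc : IsCyclic H := by
    refine isCyclic_of_injective (Abelianization.of.comp H.subtype) ?_
    rw [injective_iff_map_eq_one]
    intro a ha
    have h1 : (a : G) ∈ commutator G := by
      rw [← Abelianization.ker_of]; exact ha
    have := hH.disjoint.le_bot ⟨h1, a.2⟩
    exact Subtype.ext (Subgroup.mem_bot.1 this)
  obtain ⟨⟨h, hhH⟩, hh⟩ := hHc.exists_generator
  have hho : orderOf h = 42 := by
    rw [← hHcard, ← orderOf_eq_card_of_forall_mem_zpowers hh, Subgroup.orderOf_mk]
  have := isCyclic_of_prime_card hcomm13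
  obtain ⟨⟨x, hxK⟩, hx⟩ := IsCyclic.exists_generator (α := commutator G)
  have hxo : orderOf x = 13 := by
    rw [← hcomm13, ← orderOf_eq_card_of_forall_mem_zpowers hx, Subgroup.orderOf_mk]
  have hKx : commutator G = Subgroup.zpowers x := by
    refine (Subgroup.eq_of_le_of_card_ge (Subgroup.zpowers_le.2 hxK) ?_).symm
    rw [hcomm13, Nat.card_zpowers, hxo]
  -- the centralizer of the commutator subgroup has index three
  have hpg : IsPGroup 13 (commutator G) := IsPGroup.of_card (n := 1) (by simpa using hcomm13)
  obtain ⟨P, hP⟩ := hpg.exists_le_sylow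
  have hPcard := P.card_eq_prime (m := 42) hG (by norm_num)
  have hPC : commutator G = (P : Subgroup G) :=
    Subgroup.eq_of_le_of_card_ge hP (by rw [hcomm13]; exact hPcard.le)
  have hPn : (P : Subgroup G).Normal := hPC ▸ (inferInstance : (commutator G).Normal)
  have hB := orderExp_mul_prime P hPcard
  have hone : Nat.card (Sylow 13 G) = 1 := by
    have := Sylow.unique_of_normal P hPn
    exact Nat.card_unique
  rw [hone, h13, show (P : Set G) = (commutator G : Set G) from by rw [hPC]; rfl] at hB
  have hCx (g : G) : g ∈ Subgroup.centralizer (commutator G : Set G) ↔ Commute g x := by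
    refine ⟨fun hg => (Subgroup.mem_centralizer_iff.1 hg x hxK).symm, fun hg => ?_⟩
    rw [Subgroup.mem_centralizer_iff]
    intro y hy
    rw [SetLike.mem_coe, hKx] at hy
    obtain ⟨j, rfl⟩ := Subgroup.mem_zpowers_iff.1 hy
    exact (hg.zpow_right j).symm
  have hCn : (Subgroup.centralizer (commutator G : Set G)).Normal :=
    Subgroup.normal_centralizer
  set C := Subgroup.centralizer (commutator G : Set G) with hC
  have hCi : C.index = 3 := by
    have := C.index_mul_card
    rw [hG] at this
    -- From $168\cdot 13=12\,|C|$, the Sylow 13-subgroup being normal.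
    have h182 : Nat.card C = 182 := by omega
    rw [h182] at this
    omega
  have hh3 : Commute (h ^ 3) x := by
    rw [← hCx, ← hCi]
    exact C.pow_index_mem h
  have hh1 : ¬ Commute h x := by
    intro hcom
    have h1 : H ≤ C := by
      intro a ha
      obtain ⟨j, hj⟩ := Subgroup.mem_zpowers_iff.1 (hh ⟨a, ha⟩)
      have hj' : h ^ j = a := congrArg Subtype.val hj
      rw [← hj']
      exact zpow_mem ((hCx h).2 hcom) j
    have h2 : commutator G ≤ C := by
      rw [hKx, Subgroup.zpowers_le]
      exact (hCx x).2 (Commute.refl x)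
    have h3 : C = ⊤ := by
      rw [← top_le_iff, ← hH.sup_eq_top]
      exact sup_le h2 h1
    rw [h3, Subgroup.index_top] at hCi
    omega
  obtain ⟨r, hr⟩ : ∃ r : ℕ, h * x * h⁻¹ = x ^ r := by
    have h1 : h * x * h⁻¹ ∈ Subgroup.zpowers x := by
      rw [← hKx]
      exact (inferInstance : (commutator G).Normal).conj_mem x hxK h
    rw [← mem_powers_iff_mem_zpowers] at h1
    obtain ⟨r, hr⟩ := h1
    exact ⟨r, hr.symm⟩
  have hr3 : (r : ZMod 13) ^ 3 = 1 := by
    have := conj_pow_eq_pow_pow hr 3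
    rw [hh3.eq, mul_inv_cancel_right] at this
    have h2 : x ^ 1 = x ^ r ^ 3 := by simpa using this
    rw [pow_eq_pow_iff_modEq, hxo, ← ZMod.natCast_eq_natCast_iff] at h2
    simpa using h2.symm
  have hr1 : (r : ZMod 13) ≠ 1 := by
    intro h1
    apply hh1
    have : x ^ r = x ^ 1 := by
      rw [pow_eq_pow_iff_modEq, hxo, ← ZMod.natCast_eq_natCast_iff]
      simpa using h1
    rw [this, pow_one, mul_inv_eq_iff_eq_mul] at hr
    exact hr
  obtain ⟨j, hj, hjr⟩ : ∃ j ∈ ({14, 28} : Finset ℕ), (r : ZMod 13) ^ j = 3 :=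
    exists_pow_eq_three r hr3 hr1
  -- The cyclic complement splits into $h^3$, which centralizes $x$, and $h^j$, normalized to act as
  -- the cube map $x\mapsto x^3$.
  refine ⟨h ^ 3, x, h ^ j, ?_, hxo, ?_, hh3, (Commute.refl h).pow_pow _ _, ?_⟩
  · rw [orderOf_pow, hho]; rfl
  · rw [orderOf_pow, hho]
    simp only [Finset.mem_insert, Finset.mem_singleton] at hj
    rcases hj with rfl | rfl <;> rfl
  · rw [conj_pow_eq_pow_pow hr, pow_eq_pow_iff_modEq, hxo, ← ZMod.natCast_eq_natCast_iff]
    simpa using hjr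

/-! ### Element orders in $\mathrm{PSL}(2,13)$ -/

/-- The order in `PSL(2, 13)` of the class of a non-scalar matrix with trace `t`. -/
def orderOfTrace (t : ZMod 13) : ℕ :=
  if t = 0 then 2 else if t = 1 ∨ t = 12 then 3 else if t = 2 ∨ t = 11 then 13 else
  if t = 4 ∨ t = 9 then 6 else 7

/-- The number of non-scalar matrices in `SL(2, 13)` with trace `t`. -/
def numOfTrace (t : ZMod 13) : ℕ :=
  if orderOfTrace t = 13 then 168 else if orderOfTrace t = 7 then 156 else 182

/-- The coefficients in `g ^ k = a • g - b • 1` for a matrix `g` with trace `t` and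
determinant `1`. -/
def traceCoeff (t : ZMod 13) : ℕ → ZMod 13 × ZMod 13
  | 0 => (0, -1)
  | k + 1 => (t * (traceCoeff t k).1 - (traceCoeff t k).2, (traceCoeff t k).1)

theorem traceCoeff_orderOfTrace : ∀ t : ZMod 13, (traceCoeff t (orderOfTrace t)).1 = 0 ∧
    ∀ m < orderOfTrace t, 0 < m → (traceCoeff t m).1 ≠ 0 := by
  decide +kernel

open Finset in
theorem card_filter_trace : ∀ t : ZMod 13,
    #(univ.filter fun x : ZMod 13 × ZMod 13 × ZMod 13 =>
      x.1 * (t - x.1) - x.2.1 * x.2.2 = 1 ∧ ¬ (x.2.1 = 0 ∧ x.2.2 = 0 ∧ x.1 = t - x.1)) =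
      numOfTrace t := by
  decide +kernel

open Matrix in
theorem mem_center_SL_two_iff {R : Type*} [CommRing R] (A : Matrix.SpecialLinearGroup (Fin 2) R) :
    A ∈ Subgroup.center (Matrix.SpecialLinearGroup (Fin 2) R) ↔
      A 0 1 = 0 ∧ A 1 0 = 0 ∧ A 0 0 = A 1 1 := by
  rw [Matrix.SpecialLinearGroup.mem_center_iff]
  constructor
  · rintro ⟨r, -, h⟩
    have h' (i j : Fin 2) : A i j = scalar (Fin 2) r i j := congrFun (congrFun h.symm i) j
    simp [h']
  · rintro ⟨h1, h2, h3⟩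
    have hdet := A.det_coe
    rw [det_fin_two] at hdet
    refine ⟨A 0 0, ?_, ?_⟩
    · simp only [Fintype.card_fin]
      rw [h1, h3] at hdet
      rw [h3, pow_two]
      simpa using hdet
    · ext i j
      fin_cases i <;> fin_cases j <;> simp [h1, h2, h3]

open Matrix in
-- Iterated Cayley–Hamilton, $A^2=tA-1$.
theorem SL_two_pow_eq (A : Matrix.SpecialLinearGroup (Fin 2) (ZMod 13)) (k : ℕ) :
    ((A ^ k : Matrix.SpecialLinearGroup (Fin 2) (ZMod 13)) : Matrix (Fin 2) (Fin 2) (ZMod 13)) =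
      (traceCoeff (A 0 0 + A 1 1) k).1 • (A : Matrix (Fin 2) (Fin 2) (ZMod 13)) -
        (traceCoeff (A 0 0 + A 1 1) k).2 • 1 := by
  have hdet := A.det_coe
  rw [det_fin_two] at hdet
  induction k with
  | zero => simp [traceCoeff]
  | succ k ih =>
    rw [pow_succ, Matrix.SpecialLinearGroup.coe_mul, ih]
    ext i j
    fin_cases i <;> fin_cases j <;>
      simp [Matrix.mul_apply, Fin.sum_univ_two, traceCoeff] <;> grind

open Matrix in
-- A power $aA-b$ of a nonscalar $A$ is scalar exactly when $a=0$, so the order of its class is the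
-- first positive index at which $a$ vanishes, and depends on the trace alone.
theorem orderOf_mk_PSL2_13 (A : Matrix.SpecialLinearGroup (Fin 2) (ZMod 13))
    (hA : A ∉ Subgroup.center (Matrix.SpecialLinearGroup (Fin 2) (ZMod 13))) :
    orderOf (QuotientGroup.mk A : PSL2_13) = orderOfTrace (A 0 0 + A 1 1) := by
  have : Fact (Nat.Prime 13) := ⟨by norm_num⟩
  have key (k : ℕ) : (QuotientGroup.mk A : PSL2_13) ^ k = 1 ↔
      (traceCoeff (A 0 0 + A 1 1) k).1 = 0 := by
    rw [← QuotientGroup.mk_pow, QuotientGroup.eq_one_iff, mem_center_SL_two_iff]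
    rw [mem_center_SL_two_iff] at hA
    have h (i j : Fin 2) := congrFun (congrFun (SL_two_pow_eq A k) i) j
    simp only [h]
    simp
    grind
  obtain ⟨h1, h2⟩ := traceCoeff_orderOfTrace (A 0 0 + A 1 1)
  have hpos : 0 < orderOfTrace (A 0 0 + A 1 1) := by
    unfold orderOfTrace; split_ifs <;> norm_num
  rw [orderOf_eq_iff hpos]
  exact ⟨(key _).2 h1, fun m hm hm0 h => h2 m hm hm0 ((key m).1 h)⟩

open Matrix Finset in
open scoped Classical in
theorem card_noncentral_trace [Fintype (Matrix.SpecialLinearGroup (Fin 2) (ZMod 13))] (t : ZMod 13) :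
    #(univ.filter fun A : Matrix.SpecialLinearGroup (Fin 2) (ZMod 13) =>
      A ∉ Subgroup.center (Matrix.SpecialLinearGroup (Fin 2) (ZMod 13)) ∧ A 0 0 + A 1 1 = t) =
      numOfTrace t := by
  rw [← card_filter_trace t]
  refine Finset.card_bij' (fun A _ => (A 0 0, A 0 1, A 1 0))
    (fun x hx => ⟨!![x.1, x.2.1; x.2.2, t - x.1], ?_⟩) ?_ ?_ ?_ ?_
  · simpa [det_fin_two] using (Finset.mem_filter.1 hx).2.1
  · intro A hA
    simp only [mem_filter, mem_univ, true_and, mem_center_SL_two_iff] at hA ⊢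
    obtain ⟨h1, rfl⟩ := hA
    have hdet := A.det_coe
    rw [det_fin_two] at hdet
    simp only [add_sub_cancel_left]
    exact ⟨hdet, h1⟩
  · rintro ⟨a, b, c⟩ hx
    have hx2 := (Finset.mem_filter.1 hx).2.2
    refine Finset.mem_filter.2 ⟨mem_univ _, ?_, by simp⟩
    refine (mem_center_SL_two_iff _).not.2 ?_
    simpa using hx2
  · intro A hA
    simp only [mem_filter, mem_univ, true_and] at hA
    obtain ⟨h1, rfl⟩ := hA
    ext i j
    fin_cases i <;> fin_cases j <;> simp
  · rintro ⟨a, b, c⟩ hx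
    simp

open Matrix in
theorem card_center_SL_two_13 :
    Nat.card (Subgroup.center (Matrix.SpecialLinearGroup (Fin 2) (ZMod 13))) = 2 := by
  have : Fact (Nat.Prime 13) := ⟨by norm_num⟩
  have h : (Subgroup.center (Matrix.SpecialLinearGroup (Fin 2) (ZMod 13)) :
      Set (Matrix.SpecialLinearGroup (Fin 2) (ZMod 13))) = {1, -1} := by
    ext A
    simp only [SetLike.mem_coe, mem_center_SL_two_iff, Set.mem_insert_iff, Set.mem_singleton_iff]
    constructor
    · rintro ⟨h1, h2, h3⟩
      have hdet := A.det_coe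
      rw [det_fin_two, h1, h3, zero_mul, sub_zero, mul_self_eq_one_iff] at hdet
      rcases hdet with h4 | h4
      · left; ext i j
        fin_cases i <;> fin_cases j <;> simp [h1, h2, h3, h4]
      · right; ext i j
        fin_cases i <;> fin_cases j <;> simp [h1, h2, h3, h4]
    · rintro (rfl | rfl) <;> simp
  have hne : (1 : Matrix.SpecialLinearGroup (Fin 2) (ZMod 13)) ≠ -1 := by
    intro h
    have := congrArg (fun A : Matrix.SpecialLinearGroup (Fin 2) (ZMod 13) => A 0 0) h
    simp only [Matrix.SpecialLinearGroup.coe_one, Matrix.SpecialLinearGroup.coe_neg, Matrix.neg_apply,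
      Matrix.one_apply_eq] at this
    exact absurd this (by decide)
  rw [← SetLike.coe_sort_coe, h, Nat.card_coe_set_eq, Set.ncard_pair hne]

theorem sum_numOfTrace_mul (f : ℕ → ℕ) : ∑ t : ZMod 13, numOfTrace t * f (orderOfTrace t) =
    182 * f 2 + 364 * f 3 + 364 * f 6 + 936 * f 7 + 336 * f 13 := by
  have h : ∀ t ∈ (Finset.univ : Finset (ZMod 13)),
      orderOfTrace t ∈ ({2, 3, 6, 7, 13} : Finset ℕ) := by decide
  have h2 (n : ℕ) : ∑ t : ZMod 13 with orderOfTrace t = n, numOfTrace t * f (orderOfTrace t) =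
      (∑ t : ZMod 13 with orderOfTrace t = n, numOfTrace t) * f n := by
    rw [Finset.sum_mul]
    exact Finset.sum_congr rfl fun t ht => by rw [(Finset.mem_filter.1 ht).2]
  have c2 : ∑ t : ZMod 13 with orderOfTrace t = 2, numOfTrace t = 182 := by decide
  have c3 : ∑ t : ZMod 13 with orderOfTrace t = 3, numOfTrace t = 364 := by decide
  have c6 : ∑ t : ZMod 13 with orderOfTrace t = 6, numOfTrace t = 364 := by decide
  have c7 : ∑ t : ZMod 13 with orderOfTrace t = 7, numOfTrace t = 936 := by decide
  have c13 : ∑ t : ZMod 13 with orderOfTrace t = 13, numOfTrace t = 336 := by decide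
  rw [← Finset.sum_fiberwise_of_maps_to h]
  simp only [h2]
  simp [c2, c3, c6, c7, c13, add_assoc]

open Matrix Finset in
open scoped Classical in
-- Sum over $\mathrm{SL}(2,13)$ by trace, the two scalar matrices apart, and halve: the center has
-- order 2.
theorem sum_orderOf_PSL2_13 [Fintype PSL2_13] (f : ℕ → ℕ) :
    ∑ x : PSL2_13, f (orderOf x) = 91 * f 2 + 182 * f 3 + 182 * f 6 + 468 * f 7 + 168 * f 13 + f 1 := by
  have : Fact (Nat.Prime 13) := ⟨by norm_num⟩
  have := Fintype.ofFinite (Matrix.SpecialLinearGroup (Fin 2) (ZMod 13))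
  have h1 : ∑ A : Matrix.SpecialLinearGroup (Fin 2) (ZMod 13), f (orderOf (QuotientGroup.mk A : PSL2_13)) =
      2 * ∑ x : PSL2_13, f (orderOf x) := by
    have := Fintype.ofFinite (Subgroup.center (Matrix.SpecialLinearGroup (Fin 2) (ZMod 13)))
    rw [Fintype.sum_equiv (Subgroup.groupEquivQuotientProdSubgroup
      (s := Subgroup.center (Matrix.SpecialLinearGroup (Fin 2) (ZMod 13))))
      (fun A => f (orderOf (QuotientGroup.mk A : PSL2_13)))
      (fun x => f (orderOf x.1)) (fun A => rfl), Fintype.sum_prod_type]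
    simp only [sum_const, smul_eq_mul, card_univ]
    rw [← Nat.card_eq_fintype_card, card_center_SL_two_13, Finset.mul_sum]
  have h2 : ∑ A : Matrix.SpecialLinearGroup (Fin 2) (ZMod 13), f (orderOf (QuotientGroup.mk A : PSL2_13)) =
      2 * f 1 + ∑ t : ZMod 13, numOfTrace t * f (orderOfTrace t) := by
    rw [← Finset.sum_filter_add_sum_filter_not univ
      (fun A => A ∈ Subgroup.center (Matrix.SpecialLinearGroup (Fin 2) (ZMod 13)))]
    congr 1
    · have hc := card_center_SL_two_13
      rw [Nat.card_eq_fintype_card, Fintype.card_subtype] at hc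
      refine Eq.trans ?_ (congrArg (· * f 1) hc)
      rw [← smul_eq_mul, ← Finset.sum_const]
      refine Finset.sum_congr rfl fun A hA => ?_
      rw [(QuotientGroup.eq_one_iff A).2 (Finset.mem_filter.1 hA).2, orderOf_one]
    · rw [← Finset.sum_fiberwise _
        (fun A : Matrix.SpecialLinearGroup (Fin 2) (ZMod 13) => A 0 0 + A 1 1)]
      refine Finset.sum_congr rfl fun t _ => ?_
      rw [← card_noncentral_trace, ← smul_eq_mul, ← Finset.sum_const, Finset.filter_filter]
      refine Finset.sum_congr rfl fun A hA => ?_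
      obtain ⟨h3, h4⟩ := (Finset.mem_filter.1 hA).2
      rw [orderOf_mk_PSL2_13 A h3, h4]
  rw [sum_numOfTrace_mul] at h2
  omega

theorem card_PSL2_13 : Nat.card PSL2_13 = 1092 := by
  have : Fact (Nat.Prime 13) := ⟨by norm_num⟩
  have := Fintype.ofFinite PSL2_13
  have h := sum_orderOf_PSL2_13 (fun _ => 1)
  simpa using h

theorem orderExp_PSL2_13 [Finite PSL2_13] : orderExp 2 PSL2_13 = 273 ∧ orderExp 3 PSL2_13 = 364 ∧
    orderExp 7 PSL2_13 = 468 ∧ orderExp 13 PSL2_13 = 168 := by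
  have := Fintype.ofFinite PSL2_13
  have h (p : ℕ) : orderExp p PSL2_13 = _ :=
    (orderExp_eq_sum p _).trans (sum_orderOf_PSL2_13 (fun n => n.factorization p))
  have h2 := Nat.Prime.factorization (p := 2) (by norm_num)
  have h3 := Nat.Prime.factorization (p := 3) (by norm_num)
  have h7 := Nat.Prime.factorization (p := 7) (by norm_num)
  have h13 := Nat.Prime.factorization (p := 13) (by norm_num)
  have h6 : (6 : ℕ).factorization = Nat.factorization 2 + Nat.factorization 3 :=
    Nat.factorization_mul (a := 2) (b := 3) (by norm_num) (by norm_num)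
  refine ⟨?_, ?_, ?_, ?_⟩ <;> rw [h] <;> simp [h2, h3, h6, h7, h13]

/-! ### The projective line and recognition of $\mathrm{PSL}(2,13)$ -/

instance fact_prime_thirteen : Fact (Nat.Prime 13) := ⟨by norm_num⟩

open OnePoint in
/-- The action of `SL(2, 13)` on the projective line by Möbius transformations. -/
noncomputable def moebiusSL :
    Matrix.SpecialLinearGroup (Fin 2) (ZMod 13) →* Equiv.Perm (OnePoint (ZMod 13)) :=
  (MulAction.toPermHom (GL (Fin 2) (ZMod 13)) (OnePoint (ZMod 13))).comp
    Matrix.SpecialLinearGroup.toGL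

section
open OnePoint

theorem moebiusSL_infty (A : Matrix.SpecialLinearGroup (Fin 2) (ZMod 13)) :
    moebiusSL A ∞ = if A 1 0 = 0 then ∞ else ((A 0 0 / A 1 0 : ZMod 13) : OnePoint (ZMod 13)) :=
  OnePoint.smul_infty_eq_ite _

theorem moebiusSL_coe (A : Matrix.SpecialLinearGroup (Fin 2) (ZMod 13)) (x : ZMod 13) :
    moebiusSL A x = if A 1 0 * x + A 1 1 = 0 then ∞ else
      (((A 0 0 * x + A 0 1) / (A 1 0 * x + A 1 1) : ZMod 13) : OnePoint (ZMod 13)) :=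
  OnePoint.smul_some_eq_ite

theorem moebiusSL_of_mem_center (A : Matrix.SpecialLinearGroup (Fin 2) (ZMod 13))
    (hA : A ∈ Subgroup.center (Matrix.SpecialLinearGroup (Fin 2) (ZMod 13))) :
    moebiusSL A = 1 := by
  obtain ⟨h1, h2, h3⟩ := (mem_center_SL_two_iff A).1 hA
  have hdet := A.det_coe
  rw [Matrix.det_fin_two, h1, h3, zero_mul, sub_zero] at hdet
  have h0 : A 1 1 ≠ 0 := by rintro h0; simp [h0] at hdet
  ext x
  induction x using OnePoint.rec with
  | infty => simp [moebiusSL_infty, h2]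
  | coe x => simp [moebiusSL_coe, h1, h2, h3, h0]

/-- The action of `PSL(2, 13)` on the projective line. -/
noncomputable def moebiusPSL : PSL2_13 →* Equiv.Perm (OnePoint (ZMod 13)) :=
  QuotientGroup.lift _ moebiusSL moebiusSL_of_mem_center

/-- $s^6=1$ says that $s$ is a nonzero square modulo 13, and the diagonal matrix entries $r,r^{-1}$
produce exactly the ratios $r^2$. -/
theorem exists_moebiusSL_affine (s b : ZMod 13) (hs : s ^ 6 = 1) :
    ∃ A, moebiusSL A ∞ = ∞ ∧ ∀ x : ZMod 13, moebiusSL A x = ((s * x + b : ZMod 13) : OnePoint _) := by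
  obtain ⟨r, rfl⟩ : ∃ r : ZMod 13, s = r ^ 2 := by
    revert s
    decide +kernel
  have hr : r ≠ 0 := by rintro rfl; simp at hs
  refine ⟨⟨!![r, b * r⁻¹; 0, r⁻¹], by simp [Matrix.det_fin_two, hr]⟩, ?_, fun x => ?_⟩
  · refine (moebiusSL_infty _).trans ?_; simp
  · refine (moebiusSL_coe _ _).trans ?_
    simp [hr]
    field_simp

theorem exists_moebiusSL_inversion (r : ZMod 13) (hr : r ≠ 0) :
    ∃ A, moebiusSL A ∞ = (0 : ZMod 13) ∧ moebiusSL A (0 : ZMod 13) = ∞ ∧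
      ∀ x : ZMod 13, x ≠ 0 → moebiusSL A x = ((-r ^ 2 * x⁻¹ : ZMod 13) : OnePoint _) := by
  refine ⟨⟨!![0, -r; r⁻¹, 0], by simp [Matrix.det_fin_two, hr]⟩, ?_, ?_, fun x hx => ?_⟩
  · refine (moebiusSL_infty _).trans ?_; simp [hr]
  · refine (moebiusSL_coe _ _).trans ?_; simp
  · refine (moebiusSL_coe _ _).trans ?_
    simp [hr, hx]
    field_simp
end

/-- The map on the projective line with `∞ ↦ 0 ↦ ∞`, `1 ↦ c`, `2 ↦ d` that transforms
multiplication by `4` into multiplication by `m`. -/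
def swapMap (m c d : ZMod 13) : Option (ZMod 13) → Option (ZMod 13)
  | none => some 0
  | some x =>
    if x = 0 then none
    else if x = 1 then some c
    else if x = 4 then some (m * c)
    else if x = 3 then some (m * (m * c))
    else if x = 12 then some (m * (m * (m * c)))
    else if x = 9 then some (m * (m * (m * (m * c))))
    else if x = 10 then some (m * (m * (m * (m * (m * c)))))
    else if x = 2 then some d
    else if x = 8 then some (m * d)
    else if x = 6 then some (m * (m * d))
    else if x = 11 then some (m * (m * (m * d)))
    else if x = 5 then some (m * (m * (m * (m * d))))
    else some (m * (m * (m * (m * (m * d)))))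

/-- A word in a `swapMap` and translations that fixes `∞`. -/
def swapWord (m c d : ZMod 13) (x : Option (ZMod 13)) : Option (ZMod 13) :=
  swapMap m c d ((swapMap m c d ((swapMap m c d x).map (· + 1))).map (· + -c))

/-- `swapWord` acts as an affine map whose ratio is a nonzero square. -/
def swapWordAffine (m c d : ZMod 13) : Bool :=
  match swapWord m c d (some 0), swapWord m c d (some 1) with
  | some b, some e => decide ((e - b) ^ 6 = 1) &&
      decide (∀ x, swapWord m c d (some x) = some ((e - b) * x + b))
  | _, _ => false

/-- Exhaustive check. The list consists of the nonzero squares; among the candidates for a map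
swapping $0$ and $\infty$, the affine condition on one word leaves only the Möbius inversions. -/
theorem swapMap_eq_inversion : ∀ m ∈ ([1, 3, 4, 9, 10, 12] : List (ZMod 13)), ∀ c d : ZMod 13,
    c ≠ 0 → d ≠ 0 → swapWordAffine m c d →
    ∃ r : ZMod 13, r ≠ 0 ∧ ∀ x : ZMod 13, x ≠ 0 → swapMap m c d (some x) = some (-r ^ 2 * x⁻¹) := by
  decide +kernel

theorem mem_list_of_pow_six : ∀ m : ZMod 13, m ^ 6 = 1 →
    m ∈ ([1, 3, 4, 9, 10, 12] : List (ZMod 13)) := by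
  decide +kernel

open OnePoint in
-- Since $tht^{-1}$ fixes $0$ and $\infty$, it is multiplication by some $m$. As 4 generates the
-- squares and 2 is a nonsquare, $t$ is determined by $m$, $t(1)=c$ and $t(2)=d$, and the finite
-- check makes $t$ Möbius.
theorem nonempty_mulEquiv_PSL2_13 {G : Type*} [Group G] [Finite G] (hG : Nat.card G = 1092)
    (φ : G →* Equiv.Perm (OnePoint (ZMod 13))) (hφ : Function.Injective φ) {u h t : G}
    (hu0 : φ u ∞ = ∞) (hu : ∀ x : ZMod 13, φ u x = ((x + 1 : ZMod 13) : OnePoint _))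
    (hst : ∀ g, φ g ∞ = ∞ → ∃ s b : ZMod 13, s ^ 6 = 1 ∧
      ∀ x : ZMod 13, φ g x = ((s * x + b : ZMod 13) : OnePoint _))
    (hh0 : φ h ∞ = ∞) (hh : ∀ x : ZMod 13, φ h x = ((4 * x : ZMod 13) : OnePoint _))
    (ht0 : φ t ∞ = (0 : ZMod 13)) (ht1 : φ t (0 : ZMod 13) = ∞) :
    Nonempty (G ≃* PSL2_13) := by
  have hu0k (k : ℕ) : φ (u ^ k) ∞ = ∞ := by
    induction k with
    | zero => simp
    | succ k ih => rw [pow_succ, map_mul, Equiv.Perm.mul_apply, hu0, ih]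
  have huk (k : ℕ) (x : ZMod 13) : φ (u ^ k) x = ((x + k : ZMod 13) : OnePoint _) := by
    induction k generalizing x with
    | zero => simp
    | succ k ih =>
      rw [pow_succ, map_mul, Equiv.Perm.mul_apply, hu, ih]
      push_cast
      congr 1
      ring
  have huv (a x : ZMod 13) : φ (u ^ a.val) x = ((x + a : ZMod 13) : OnePoint _) := by
    rw [huk, ZMod.natCast_zmod_val]
  -- conjugation by `t` of the multiplication by four
  have hc0 : φ (t * h * t⁻¹) ∞ = ∞ := by
    rw [map_mul, map_mul, Equiv.Perm.mul_apply, Equiv.Perm.mul_apply, map_inv,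
      Equiv.Perm.inv_eq_iff_eq.2 ht1.symm, hh, mul_zero, ht1]
  obtain ⟨m, b, hm, hmb⟩ := hst _ hc0
  have hb : b = 0 := by
    have := hmb 0
    rw [map_mul, map_mul, Equiv.Perm.mul_apply, Equiv.Perm.mul_apply, map_inv,
      Equiv.Perm.inv_eq_iff_eq.2 ht0.symm, hh0, ht0, mul_zero, zero_add, OnePoint.coe_eq_coe] at this
    exact this.symm
  have ht4 (x y : ZMod 13) (hxy : φ t x = (y : OnePoint (ZMod 13))) :
      φ t ((4 * x : ZMod 13) : OnePoint _) = ((m * y : ZMod 13) : OnePoint _) := by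
    have := hmb y
    rw [← hxy, ← Equiv.Perm.mul_apply, ← map_mul, inv_mul_cancel_right, map_mul,
      Equiv.Perm.mul_apply, hh, hb, add_zero] at this
    exact this
  have htne (x : ZMod 13) (hx : x ≠ 0) : ∃ y : ZMod 13, y ≠ 0 ∧ φ t x = (y : OnePoint _) := by
    rcases h1 : φ t x with _ | y
    · have : φ t x = φ t (0 : ZMod 13) := h1.trans ht1.symm
      exact absurd (OnePoint.coe_injective ((φ t).injective this)) hx
    · refine ⟨y, ?_, rfl⟩
      rintro rfl
      have : φ t x = φ t ∞ := h1.trans ht0.symm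
      exact OnePoint.coe_ne_infty _ ((φ t).injective this)
  obtain ⟨c, hc, htc⟩ := htne 1 (by decide)
  obtain ⟨d, hd, htd⟩ := htne 2 (by decide)
  have hswap : ∀ x : Option (ZMod 13), φ t x = swapMap m c d x := by
    have e4 := ht4 _ _ htc
    have e3 := ht4 _ _ e4
    have e12 := ht4 _ _ e3
    have e9 := ht4 _ _ e12
    have e10 := ht4 _ _ e9
    have e8 := ht4 _ _ htd
    have e6 := ht4 _ _ e8
    have e11 := ht4 _ _ e6
    have e5 := ht4 _ _ e11
    have e7 := ht4 _ _ e5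
    have hall : ∀ x : ZMod 13, x = 0 ∨ x = 1 ∨ x = 4 ∨ x = 3 ∨ x = 12 ∨ x = 9 ∨ x = 10 ∨ x = 2 ∨
      x = 8 ∨ x = 6 ∨ x = 11 ∨ x = 5 ∨ x = 7 := by decide
    rintro (_ | x)
    · exact ht0
    · rcases hall x with rfl | rfl | rfl | rfl | rfl | rfl | rfl | rfl | rfl | rfl | rfl | rfl | rfl
      · exact ht1
      · exact htc
      · exact e4
      · exact e3
      · exact e12
      · exact e9
      · exact e10
      · exact htd
      · exact e8
      · exact e6
      · exact e11
      · exact e5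
      · exact e7
  have humap (a : ZMod 13) : ∀ x : Option (ZMod 13), φ (u ^ a.val) x = x.map (· + a) := by
    rintro (_ | x)
    · exact hu0k _
    · exact huv a x
  have hw (x : Option (ZMod 13)) :
      φ (t * u ^ (-c).val * t * u ^ (1 : ZMod 13).val * t) x = swapWord m c d x := by
    simp only [map_mul]
    exact (hswap _).trans (congrArg (swapMap m c d) ((humap _ _).trans (congrArg (Option.map _)
      ((hswap _).trans (congrArg (swapMap m c d) ((humap _ _).trans
        (congrArg (Option.map _) (hswap x))))))))
  -- The word sends $\infty\mapsto0\mapsto1\mapsto c\mapsto0\mapsto\infty$, so the stabilizer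
  -- hypothesis applies to it.
  have hw0 : φ (t * u ^ (-c).val * t * u ^ (1 : ZMod 13).val * t) ∞ = ∞ := by
    simp only [map_mul, Equiv.Perm.mul_apply, ht0, huv, zero_add, htc, add_neg_cancel, ht1]
  obtain ⟨s, b', hs, hsb⟩ := hst _ hw0
  have hsw (x : ZMod 13) : swapWord m c d (Option.some x) = Option.some (s * x + b') := by
    rw [← hw]; exact hsb x
  have hgood : swapWordAffine m c d := by
    have e0 := hsw 0
    have e1 := hsw 1
    rw [mul_zero, zero_add] at e0
    rw [mul_one] at e1
    simp [swapWordAffine, e0, e1, hs, hsw]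
  obtain ⟨r, hr, hrx⟩ := swapMap_eq_inversion m (mem_list_of_pow_six m hm) c d hc hd hgood
  have htmem : φ t ∈ moebiusPSL.range := by
    obtain ⟨A, hA1, hA2, hA3⟩ := exists_moebiusSL_inversion r hr
    refine ⟨QuotientGroup.mk A, ?_⟩
    change moebiusSL A = φ t
    ext x
    induction x using OnePoint.rec with
    | infty => rw [hA1, ht0]
    | coe x =>
      by_cases hx : x = 0
      · rw [hx, hA2, ht1]
      · rw [hA3 x hx]
        exact ((hswap (Option.some x)).trans (hrx x hx)).symm
  have hfix (g : G) (hg : φ g ∞ = ∞) : φ g ∈ moebiusPSL.range := by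
    obtain ⟨s, b, hs, hsb⟩ := hst g hg
    obtain ⟨A, hA1, hA2⟩ := exists_moebiusSL_affine s b hs
    refine ⟨QuotientGroup.mk A, ?_⟩
    change moebiusSL A = φ g
    ext x
    induction x using OnePoint.rec with
    | infty => rw [hA1, hg]
    | coe x => rw [hA2, hsb]
  have hle : φ.range ≤ moebiusPSL.range := by
    rintro _ ⟨g, rfl⟩
    rcases hga : φ g ∞ with _ | a
    · exact hfix g hga
    -- Translate $a$ to $0$ and swap it back to $\infty$: $G$ is generated by $t$ and the stabilizer
    -- of $\infty$.
    · have h1 : φ (t⁻¹ * u ^ (-a).val * g) ∞ = ∞ := by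
        rw [map_mul, map_mul, Equiv.Perm.mul_apply, Equiv.Perm.mul_apply, hga, map_inv,
          Equiv.Perm.inv_eq_iff_eq, ht0]
        exact (huv (-a) a).trans (by rw [add_neg_cancel])
      have h2 := hfix _ h1
      have h3 := hfix (u ^ (-a).val) (hu0k _)
      have h4 : φ g = (φ (u ^ (-a).val))⁻¹ * φ t * φ (t⁻¹ * u ^ (-a).val * g) := by
        simp only [map_mul, map_inv]; group
      rw [h4]
      exact mul_mem (mul_mem (inv_mem h3) htmem) h2
  have : Finite PSL2_13 := Nat.finite_of_card_ne_zero (by rw [card_PSL2_13]; norm_num)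
  have hcφ : Nat.card φ.range = 1092 := by
    rw [← hG]; exact (Nat.card_congr (MonoidHom.ofInjective hφ).toEquiv).symm
  have hcJ : Nat.card moebiusPSL.range ≤ 1092 := by
    rw [← card_PSL2_13]
    exact Nat.card_le_card_of_surjective _ moebiusPSL.rangeRestrict_surjective
  have heq : φ.range = moebiusPSL.range :=
    Subgroup.eq_of_le_of_card_ge hle (by rw [hcφ]; exact hcJ)
  -- Faithfulness of the action of $\mathrm{PSL}(2,13)$ comes for free, since its image already has
  -- order 1092.
  have hbij : Function.Bijective moebiusPSL.rangeRestrict :=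
    (Nat.bijective_iff_surjective_and_card _).2
      ⟨moebiusPSL.rangeRestrict_surjective, by rw [← heq, hcφ, card_PSL2_13]⟩
  exact ⟨(MonoidHom.ofInjective hφ).trans ((MulEquiv.subgroupCongr heq).trans
    (MulEquiv.ofBijective _ hbij).symm)⟩

/-! ### Groups of order 1092 -/

section
open OnePoint
variable {G : Type*} [Group G] [Finite G]

open Finset in
open scoped Classical in
-- Elements outside the kernel have even order, so each adds at least 1 to $e_2$, and they make up
-- at least half of $G$.
theorem card_le_two_mul_orderExp_two {A : Type*} [Group A] (ψ : G →* A) (h1 : ∀ g, ψ g ^ 2 = 1)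
    (h2 : ψ ≠ 1) : Nat.card G ≤ 2 * orderExp 2 G := by
  have := Fintype.ofFinite G
  have hK : ψ.ker ≠ ⊤ := fun h => h2 ((MonoidHom.ker_eq_top_iff).1 h)
  have hidx : 2 ≤ ψ.ker.index := by
    have h3 : ψ.ker.index ≠ 1 := fun h => hK (Subgroup.index_eq_one.1 h)
    have h4 : ψ.ker.index ≠ 0 := Subgroup.index_ne_zero_of_finite
    omega
  have hcard := ψ.ker.index_mul_card
  have hle : 2 * Nat.card ψ.ker ≤ Nat.card G := by
    rw [← hcard]; exact Nat.mul_le_mul_right _ hidx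
  have hex : #(univ.filter fun g : G => g ∉ ψ.ker) ≤ orderExp 2 G := by
    rw [orderExp_eq_sum, Finset.card_filter]
    refine Finset.sum_le_sum fun g _ => ?_
    split_ifs with hg
    · exact Nat.zero_le _
    · refine Nat.prime_two.factorization_pos_of_dvd (orderOf_pos g).ne' ?_
      by_contra h3
      apply hg
      have h4 : (orderOf g).Coprime 2 := ((Nat.Prime.coprime_iff_not_dvd Nat.prime_two).2 h3).symm
      have h5 : orderOf (ψ g) ∣ Nat.gcd (orderOf g) 2 :=
        Nat.dvd_gcd (orderOf_map_dvd ψ g) (orderOf_dvd_of_pow_eq_one (h1 g))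
      rw [h4, Nat.dvd_one, orderOf_eq_one_iff] at h5
      exact h5
  have hsum := Finset.card_filter_add_card_filter_not (s := (univ : Finset G)) (fun g => g ∈ ψ.ker)
  have hker : #(univ.filter fun g : G => g ∈ ψ.ker) = Nat.card ψ.ker := by
    rw [← Fintype.card_subtype, Fintype.card_eq_nat_card]
  rw [hker, Finset.card_univ, ← Nat.card_eq_fintype_card] at hsum
  omega

theorem Sylow.eq_of_mem_of_mem {P Q : Sylow 13 G} (hP : Nat.card P = 13) {w : G} (hw : w ≠ 1)
    (h1 : w ∈ P) (h2 : w ∈ Q) : P = Q := by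
  have hQ := Sylow.card_eq_of_card_eq hP Q
  have key (R : Sylow 13 G) (hR : Nat.card R = 13) (hwR : w ∈ R) :
      (R : Subgroup G) = Subgroup.zpowers w := by
    have ho : orderOf w = 13 := by
      have := Subgroup.orderOf_dvd_natCard (R : Subgroup G) hwR
      rw [hR, Nat.dvd_prime (by norm_num)] at this
      exact this.resolve_left (by rwa [orderOf_eq_one_iff])
    refine (Subgroup.eq_of_le_of_card_ge (Subgroup.zpowers_le.2 hwR) ?_).symm
    rw [Nat.card_zpowers, ho]
    exact hR.le
  exact Sylow.ext ((key P hP h1).trans (key Q hQ h2).symm)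

/-- The labelling of Sylow subgroups by `∞ ↦ P` and `i ↦ u ^ i • Q`. -/
noncomputable def sylowLabel (P Q : Sylow 13 G) (u : G) (x : OnePoint (ZMod 13)) : Sylow 13 G :=
  x.elim P fun i => u ^ i.val • Q

/-- A coincidence $u^iQ=u^jQ$ puts $u^{i-j}$ in $P\cap N(Q)=P\cap Q$, which is trivial; surjectivity
follows from the count of 14. -/
theorem sylowLabel_bijective {P Q : Sylow 13 G} (hP : Nat.card P = 13)
    (hcard : Nat.card (Sylow 13 G) = 14) (hPQ : P ≠ Q) {u : G} (hu : u ∈ P) (huo : orderOf u = 13) :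
    Function.Bijective (sylowLabel P Q u) := by
  have hfix (i : ℕ) : u ^ i • P = P :=
    Sylow.smul_eq_iff_mem_normalizer.2 (Subgroup.le_normalizer (pow_mem hu i))
  have hne (i : ZMod 13) : P ≠ u ^ i.val • Q := by
    intro h
    rw [← hfix i.val] at h
    exact hPQ (smul_left_cancel _ h)
  have hinj : Function.Injective (sylowLabel P Q u) := by
    intro x y hxy
    induction x using OnePoint.rec with
    | infty =>
      induction y using OnePoint.rec with
      | infty => rfl
      | coe j => exact absurd hxy (hne j)
    | coe i =>
      induction y using OnePoint.rec with
      | infty => exact absurd hxy.symm (hne i)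
      | coe j =>
        have h1 : u ^ i.val • Q = u ^ j.val • Q := hxy
        have h2 : ((u ^ j.val)⁻¹ * u ^ i.val) • Q = Q := by
          rw [mul_smul, h1, inv_smul_smul]
        rw [Sylow.smul_eq_iff_mem_normalizer] at h2
        have h3 : (u ^ j.val)⁻¹ * u ^ i.val ∈ P :=
          mul_mem (inv_mem (pow_mem hu _)) (pow_mem hu _)
        have h4 : (u ^ j.val)⁻¹ * u ^ i.val ∈ (P : Subgroup G) ⊓ Q := by
          rw [← P.2.inf_normalizer_sylow Q]
          exact ⟨h3, h2⟩
        by_contra hij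
        refine hPQ (Sylow.eq_of_mem_of_mem hP (fun h5 => hij ?_) h3 h4.2)
        rw [inv_mul_eq_one, pow_eq_pow_iff_modEq, huo, ← ZMod.natCast_eq_natCast_iff] at h5
        simpa using h5.symm
  have := Fintype.ofFinite (OnePoint (ZMod 13))
  refine (Nat.bijective_iff_injective_and_card _).2 ⟨hinj, ?_⟩
  rw [hcard]
  change Nat.card (Option (ZMod 13)) = 14
  simp [Nat.card_eq_fintype_card]

/-- The exponent gives $n_{13}|C(P)|=182$, so $|N(P):C(P)|=6$ whether $n_{13}$ is 1 or 14. -/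
theorem card_sylow_of_card_1092 (hG : Nat.card G = 1092) (h2 : orderExp 2 G = 273)
    (h13 : orderExp 13 G = 168) (P : Sylow 13 G) : Nat.card (Sylow 13 G) = 14 ∧
      Nat.card (Subgroup.centralizer (P : Set G)) = 13 ∧
      Nat.card (P : Subgroup G).normalizerMonoidHom.range = 6 := by
  have hP := P.card_eq_prime (m := 84) hG (by norm_num)
  have hB := orderExp_mul_prime P hP
  rw [h13] at hB
  have hidx := (P : Subgroup G).index_mul_card
  rw [hG, show Nat.card (P : Subgroup G) = 13 from hP] at hidx
  have hdvd := P.card_dvd_index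
  rw [show (P : Subgroup G).index = 84 by omega] at hdvd
  have hmod := card_sylow_modEq_one 13 G
  have hn : Nat.card (Sylow 13 G) = 1 ∨ Nat.card (Sylow 13 G) = 14 := by
    have hle := Nat.le_of_dvd (by norm_num) hdvd
    generalize Nat.card (Sylow 13 G) = n at hdvd hmod hle
    clear hB
    unfold Nat.ModEq at hmod
    interval_cases n <;> omega
  have hN := (Subgroup.normalizer (P : Set G)).index_mul_card
  rw [← P.card_eq_index_normalizer, hG] at hN
  have hker : Nat.card (P : Subgroup G).normalizerMonoidHom.ker =
      Nat.card (Subgroup.centralizer (P : Set G)) := by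
    rw [Subgroup.normalizerMonoidHom_ker]
    exact Nat.card_congr (Subgroup.subgroupOfEquivOfLe
      (Subgroup.centralizer_le_normalizer _)).toEquiv
  have hrange : Nat.card (P : Subgroup G).normalizerMonoidHom.ker *
      Nat.card (P : Subgroup G).normalizerMonoidHom.range =
      Nat.card (Subgroup.normalizer (P : Set G)) := by
    rw [← Subgroup.index_ker]
    exact Subgroup.card_mul_index _
  rw [hker] at hrange
  have h6 : Nat.card (P : Subgroup G).normalizerMonoidHom.range = 6 := by
    rcases hn with h | h
    · rw [h] at hB hN
      have : Nat.card (Subgroup.centralizer (P : Set G)) = 182 := by omega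
      rw [this] at hrange
      omega
    · rw [h] at hB hN
      have : Nat.card (Subgroup.centralizer (P : Set G)) = 13 := by omega
      rw [this] at hrange
      omega
  rcases hn with h | h
  · exfalso
    rw [h, one_mul] at hN
    have hcyc : IsCyclic (P : Subgroup G) := isCyclic_of_prime_card hP
    let χ : Subgroup.normalizer (P : Set G) →* (ZMod (Nat.card (P : Subgroup G)))ˣ :=
      (IsCyclic.mulAutMulEquiv (P : Subgroup G)).toMonoidHom.comp
        (P : Subgroup G).normalizerMonoidHom
    have hχ (g) : χ g ^ 6 = 1 := by
      have h1 : (P : Subgroup G).normalizerMonoidHom g ^ 6 = 1 := by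
        rw [← h6, ← orderOf_dvd_iff_pow_eq_one]
        exact Subgroup.orderOf_dvd_natCard _ ⟨g, rfl⟩
      change (IsCyclic.mulAutMulEquiv (P : Subgroup G)) _ ^ 6 = 1
      rw [← map_pow, h1, map_one]
    -- If $P$ is normal, the cube of the conjugation character is a quadratic character of $G$. It
    -- is nontrivial because an automorphism of order 2 is induced, so $1092\le 2\cdot 273$, a
    -- contradiction.
    have := Fact.mk Nat.prime_two
    obtain ⟨a, ha⟩ := exists_prime_orderOf_dvd_card'
      (G := (P : Subgroup G).normalizerMonoidHom.range) 2 (by rw [h6]; norm_num)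
    obtain ⟨g, hga⟩ := a.2
    rw [← Subgroup.orderOf_coe] at ha
    have hle := card_le_two_mul_orderExp_two ((powMonoidHom 3).comp χ) (fun g => by
      change (χ g ^ 3) ^ 2 = 1
      rw [← pow_mul]; exact hχ g) (fun hone => by
      have h1 : χ g ^ 3 = 1 := DFunLike.congr_fun hone g
      have h2 : (a : MulAut (P : Subgroup G)) ^ 3 = 1 := by
        apply (IsCyclic.mulAutMulEquiv (P : Subgroup G)).injective
        rw [map_pow, map_one, ← hga]
        exact h1
      have h3 := orderOf_dvd_of_pow_eq_one h2
      rw [ha] at h3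
      omega)
    have htop : Subgroup.normalizer (P : Set G) = ⊤ := by
      rw [← Subgroup.card_eq_iff_eq_top, hN, hG]
    rw [hN, orderExp_congr 2 ((MulEquiv.subgroupCongr htop).trans Subgroup.topEquiv), h2] at hle
    omega
  · refine ⟨h, ?_, h6⟩
    rw [h] at hB
    omega

/-- Label the Sylow 13-subgroups by $\infty\mapsto P$, $i\mapsto u^iQ$. Then $u$ acts as $x\mapsto
x+1$, and $g\in N(P)$ with $gug^{-1}=u^s$ acts as $x\mapsto sx+b$. -/
theorem nonempty_mulEquiv_of_card_1092 (hG : Nat.card G = 1092) (h2 : orderExp 2 G = 273)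
    (h13 : orderExp 13 G = 168) : Nonempty (G ≃* PSL2_13) := by
  let P : Sylow 13 G := default
  have hP := P.card_eq_prime (m := 84) hG (by norm_num)
  obtain ⟨hcard, hC, h6⟩ := card_sylow_of_card_1092 hG h2 h13 P
  obtain ⟨u, huP, huo⟩ : ∃ u ∈ P, orderOf u = 13 := by
    obtain ⟨u, hu⟩ := exists_prime_orderOf_dvd_card' (G := P) 13 (by rw [hP])
    exact ⟨u, u.2, by rw [Subgroup.orderOf_coe, hu]⟩
  have hPu : (P : Subgroup G) = Subgroup.zpowers u := by
    refine (Subgroup.eq_of_le_of_card_ge (Subgroup.zpowers_le.2 huP) ?_).symm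
    rw [Nat.card_zpowers, huo]
    exact hP.le
  have hmemP {x : G} (hx : x ∈ P) : ∃ k : ZMod 13, x = u ^ k.val := by
    have hx' : x ∈ (P : Subgroup G) := hx
    rw [hPu, ← mem_powers_iff_mem_zpowers] at hx'
    obtain ⟨k, rfl⟩ := hx'
    exact ⟨k, by rw [pow_eq_pow_iff_modEq, huo, ← ZMod.natCast_eq_natCast_iff]; simp⟩
  have hpow {a b : ℕ} : u ^ a = u ^ b ↔ (a : ZMod 13) = b := by
    rw [pow_eq_pow_iff_modEq, huo, ← ZMod.natCast_eq_natCast_iff]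
  obtain ⟨Q, hPQ⟩ : ∃ Q : Sylow 13 G, P ≠ Q := by
    by_contra! h
    have : Subsingleton (Sylow 13 G) := ⟨fun a b => (h a).symm.trans (h b)⟩
    have := Finite.card_le_one_iff_subsingleton.2 this
    omega
  -- the action of the normalizer on the Sylow subgroup
  have hcent (g : G) : g ∈ Subgroup.centralizer (P : Set G) ↔ Commute g u := by
    refine ⟨fun hg => (Subgroup.mem_centralizer_iff.1 hg u huP).symm, fun hg => ?_⟩
    rw [Subgroup.mem_centralizer_iff]
    intro y hy
    obtain ⟨k, rfl⟩ := hmemP hy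
    exact (hg.pow_right _).symm
  have hconj (g : G) (hg : g ∈ Subgroup.normalizer (P : Set G)) :
      ∃ s : ZMod 13, s ^ 6 = 1 ∧ g * u * g⁻¹ = u ^ s.val := by
    obtain ⟨s, hs⟩ := hmemP ((Subgroup.mem_normalizer_iff.1 hg u).1 huP)
    refine ⟨s, ?_, hs⟩
    have h1 : (P : Subgroup G).normalizerMonoidHom ⟨g, hg⟩ ^ 6 = 1 := by
      rw [← h6, ← orderOf_dvd_iff_pow_eq_one]
      exact Subgroup.orderOf_dvd_natCard _ ⟨_, rfl⟩
    rw [← map_pow, ← MonoidHom.mem_ker, Subgroup.normalizerMonoidHom_ker,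
      Subgroup.mem_subgroupOf] at h1
    have h2 : Commute (g ^ 6) u := (hcent _).1 h1
    have h3 := conj_pow_eq_pow_pow hs 6
    rw [h2.eq, mul_inv_cancel_right] at h3
    nth_rewrite 1 [← pow_one u] at h3
    rw [hpow] at h3
    simpa using h3.symm
  -- The six induced automorphisms of $P$ inject into the six roots of $s^6=1$, so every root, in
  -- particular 4, occurs.
  have hfour : ∃ g ∈ Subgroup.normalizer (P : Set G), g * u * g⁻¹ = u ^ (4 : ZMod 13).val := by
    have hex (a : (P : Subgroup G).normalizerMonoidHom.range) : ∃ s : {s : ZMod 13 // s ^ 6 = 1},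
        ((a : MulAut (P : Subgroup G)) ⟨u, huP⟩ : G) = u ^ s.1.val := by
      obtain ⟨g, hg⟩ := a.2
      obtain ⟨s, hs, hgs⟩ := hconj g g.2
      exact ⟨⟨s, hs⟩, by rw [← hg, ← hgs]; rfl⟩
    choose F hF using hex
    have hinj : Function.Injective F := by
      intro a b hab
      apply Subtype.ext
      ext ⟨x, hx⟩
      obtain ⟨k, rfl⟩ := hmemP hx
      have h1 : ((a : MulAut (P : Subgroup G)) ⟨u, huP⟩) = (b : MulAut (P : Subgroup G)) ⟨u, huP⟩ :=
        Subtype.ext (by rw [hF a, hF b, hab])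
      have h2 : (⟨u ^ k.val, hx⟩ : (P : Subgroup G)) = ⟨u, huP⟩ ^ k.val := rfl
      rw [h2, map_pow, map_pow, h1]
    have hbij : Function.Bijective F := by
      refine (Nat.bijective_iff_injective_and_card _).2 ⟨hinj, ?_⟩
      rw [h6, Nat.card_eq_fintype_card]
      decide +kernel
    obtain ⟨a, ha⟩ := hbij.2 ⟨4, by decide⟩
    obtain ⟨g, hg⟩ := a.2
    refine ⟨g, g.2, ?_⟩
    have h1 := hF a
    rw [ha] at h1
    rw [← h1, ← hg]
    rfl
  -- the permutation representation
  let e : OnePoint (ZMod 13) ≃ Sylow 13 G :=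
    Equiv.ofBijective _ (sylowLabel_bijective hP hcard hPQ huP huo)
  have he0 : e ∞ = P := rfl
  have he (i : ZMod 13) : e i = u ^ i.val • Q := rfl
  let φ : G →* Equiv.Perm (OnePoint (ZMod 13)) :=
    (e.symm.permCongrHom).toMonoidHom.comp (MulAction.toPermHom G (Sylow 13 G))
  have hφ (g : G) (x y : OnePoint (ZMod 13)) : φ g x = y ↔ g • e x = e y := by
    change e.symm (g • e x) = y ↔ _
    exact e.symm_apply_eq
  have hshift (b x : ZMod 13) : φ (u ^ b.val) x = ((x + b : ZMod 13) : OnePoint _) := by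
    rw [hφ, he, he, ← mul_smul, ← pow_add]
    congr 1
    rw [hpow]
    simp [add_comm]
  have hnorm (g : G) : φ g ∞ = ∞ ↔ g ∈ Subgroup.normalizer (P : Set G) := by
    rw [hφ, he0]
    exact Sylow.smul_eq_iff_mem_normalizer
  have hu0 (k : ℕ) : φ (u ^ k) ∞ = ∞ := (hnorm _).2 (Subgroup.le_normalizer (pow_mem huP k))
  have haff (g : G) (hg : g ∈ Subgroup.normalizer (P : Set G)) (s : ZMod 13)
      (hs : g * u * g⁻¹ = u ^ s.val) :
      ∃ b : ZMod 13, ∀ x : ZMod 13, φ g x = ((s * x + b : ZMod 13) : OnePoint _) := by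
    rcases hb : φ g (0 : ZMod 13) with _ | b
    · exact absurd ((φ g).injective (hb.trans ((hnorm g).2 hg).symm)) (OnePoint.coe_ne_infty _)
    · refine ⟨b, fun x => ?_⟩
      have hb' : g • Q = u ^ b.val • Q := by
        have := (hφ _ _ _).1 hb
        rwa [he, ZMod.val_zero, pow_zero, one_smul] at this
      rw [hφ, he, he, ← mul_smul, show g * u ^ x.val = (g * u * g⁻¹) ^ x.val * g by
        rw [conj_pow]; group, mul_smul, hb', ← mul_smul, hs, ← pow_mul, ← pow_add]
      congr 1
      rw [hpow]
      simp
  have hinj : Function.Injective φ := by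
    rw [injective_iff_map_eq_one]
    intro g hg
    have hgx (x) : φ g x = x := by rw [hg]; rfl
    have hgN := (hnorm g).1 (hgx ∞)
    obtain ⟨s, -, hs⟩ := hconj g hgN
    obtain ⟨b, hb⟩ := haff g hgN s hs
    have hb0 : b = 0 := by
      have := (hb 0).symm.trans (hgx _)
      rw [mul_zero, zero_add, OnePoint.coe_eq_coe] at this
      exact this
    have hs1 : s = 1 := by
      have := (hb 1).symm.trans (hgx _)
      rw [mul_one, hb0, add_zero, OnePoint.coe_eq_coe] at this
      exact this
    have hgC : g ∈ Subgroup.centralizer (P : Set G) := by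
      rw [hcent]
      rw [hs1, ZMod.val_one, pow_one, mul_inv_eq_iff_eq_mul] at hs
      exact hs
    -- $C(P)$ has order 13, so it is $P$ itself, on which the action by translations is faithful.
    have hCP : Subgroup.zpowers u = Subgroup.centralizer (P : Set G) := by
      refine Subgroup.eq_of_le_of_card_ge (Subgroup.zpowers_le.2 ((hcent u).2 (Commute.refl u))) ?_
      rw [hC, Nat.card_zpowers, huo]
    rw [← hCP, ← hPu] at hgC
    obtain ⟨k, rfl⟩ := hmemP hgC
    have := (hshift k 0).symm.trans (hgx _)
    rw [zero_add, OnePoint.coe_eq_coe] at this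
    rw [this, ZMod.val_zero, pow_zero]
  obtain ⟨g, hgN, hg4⟩ := hfour
  obtain ⟨b, hb⟩ := haff g hgN 4 hg4
  obtain ⟨w, hw⟩ := MulAction.exists_smul_eq G P Q
  -- The conjugate $wuw^{-1}$ generates $Q$, which permutes the other 13 Sylow subgroups
  -- transitively. Correcting $w$ by one of its powers keeps $P\mapsto Q$ and adds $Q\mapsto P$.
  obtain ⟨j, hj⟩ : ∃ j : ℕ, w • Q = (w * u * w⁻¹) ^ j • P := by
    have hvQ : w * u * w⁻¹ ∈ Q := by
      rw [← hw]
      exact ⟨u, huP, rfl⟩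
    have hvo : orderOf (w * u * w⁻¹) = 13 := by
      rw [← huo]
      exact orderOf_injective (MulAut.conj w).toMonoidHom (MulAut.conj w).injective u
    obtain ⟨x, hx⟩ := (sylowLabel_bijective (Sylow.card_eq_of_card_eq hP Q) hcard hPQ.symm
      hvQ hvo).2 (w • Q)
    induction x using OnePoint.rec with
    | infty =>
      have h1 : Q = w • Q := hx
      nth_rewrite 1 [← hw] at h1
      exact absurd (smul_left_cancel _ h1) hPQ
    | coe i => exact ⟨i.val, hx.symm⟩
  refine nonempty_mulEquiv_PSL2_13 hG φ hinj (u := u) (h := u ^ (-b).val * g)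
    (t := ((w * u * w⁻¹) ^ j)⁻¹ * w) ?_ ?_ ?_ ?_ ?_ ?_ ?_
  · simpa using hu0 1
  · intro x
    have := hshift 1 x
    rwa [ZMod.val_one, pow_one] at this
  · intro g hg
    obtain ⟨s, hs, hgs⟩ := hconj g ((hnorm g).1 hg)
    obtain ⟨b, hb⟩ := haff g ((hnorm g).1 hg) s hgs
    exact ⟨s, b, hs, hb⟩
  · rw [map_mul, Equiv.Perm.mul_apply, (hnorm g).2 hgN, hu0]
  · intro x
    rw [map_mul, Equiv.Perm.mul_apply, hb, hshift, add_neg_cancel_right]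
  · rw [hφ, he0, he, ZMod.val_zero, pow_zero, one_smul, mul_smul, hw, inv_smul_eq_iff, conj_pow,
      mul_smul, mul_smul, ← hw, inv_smul_smul]
    congr 1
    exact (Sylow.smul_eq_iff_mem_normalizer.2 (Subgroup.le_normalizer (pow_mem huP j))).symm
  · rw [hφ, he0, he, ZMod.val_zero, pow_zero, one_smul, mul_smul, inv_smul_eq_iff, hj]
end

/-! ### Exponents of the product group, and the conclusion -/

theorem ExpRho_eq_of_orderExp {G : Type*} [Group G] [Finite G]
    (hG : Nat.card G = 546 ∨ Nat.card G = 1092) (h2 : orderExp 2 G = 273)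
    (h3 : orderExp 3 G = 364) (h7 : orderExp 7 G = 468) (h13 : orderExp 13 G = 168) :
    ExpRho G = {168, 273, 364, 468} := by
  have hdvd : Nat.card G ∣ 2 ^ 2 * (3 * (7 * 13)) := by
    rcases hG with h | h <;> rw [h] <;> norm_num
  ext a
  rw [mem_ExpRho_iff]
  simp only [Set.mem_insert_iff, Set.mem_singleton_iff]
  constructor
  · rintro ⟨p, hp, hpn, rfl⟩
    have h := hpn.trans hdvd
    rw [hp.dvd_mul, hp.dvd_mul, hp.dvd_mul,
      Nat.prime_dvd_prime_iff_eq (q := 3) hp (by norm_num),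
      Nat.prime_dvd_prime_iff_eq (q := 7) hp (by norm_num),
      Nat.prime_dvd_prime_iff_eq (q := 13) hp (by norm_num)] at h
    rcases h with h | rfl | rfl | rfl
    · obtain rfl := (Nat.prime_dvd_prime_iff_eq hp Nat.prime_two).1 (hp.dvd_of_dvd_pow h)
      simp [h2]
    · simp [h3]
    · simp [h7]
    · simp [h13]
  · rintro (rfl | rfl | rfl | rfl)
    · exact ⟨13, by norm_num, by omega, h13⟩
    · exact ⟨2, by norm_num, by omega, h2⟩
    · exact ⟨3, by norm_num, by omega, h3⟩
    · exact ⟨7, by norm_num, by omega, h7⟩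

theorem card_Z14Z13Z3 : Nat.card Z14Z13Z3 = 546 := by
  rw [Nat.card_prod, SemidirectProduct.card]
  simp [Nat.card_eq_fintype_card, ZMod.card]

instance finite_Z14Z13Z3 : Finite Z14Z13Z3 :=
  Nat.finite_of_card_ne_zero (by rw [card_Z14Z13Z3]; norm_num)

/-- As $p$ divides $|G|=pm$ exactly once, $e_p$ counts the elements of order divisible by $p$, and
$g^m=1$ characterizes the others. Such solution counts are multiplicative over direct products. -/
theorem orderExp_add_card_pow_eq_one {G : Type*} [Group G] [Finite G] {p m : ℕ}
    [hp : Fact p.Prime] (h : Nat.card G = p * m) (hm : ¬ p ∣ m) :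
    orderExp p G + Nat.card {g : G // g ^ m = 1} = Nat.card G := by
  classical
  have := Fintype.ofFinite G
  have hm0 : m ≠ 0 := fun h0 => hm (h0 ▸ dvd_zero p)
  have hf : (Nat.card G).factorization p = 1 := by
    rw [h, Nat.factorization_mul hp.out.ne_zero hm0]
    simp [hp.out.factorization_self, Nat.factorization_eq_zero_of_not_dvd hm]
  have hcompl : ordCompl[p] (Nat.card G) = m := by
    rw [hf, pow_one, h, Nat.mul_div_cancel_left _ hp.out.pos]
  have h1 (g : G) : g ^ m = 1 ↔ ¬ p ∣ orderOf g := by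
    rw [← pow_ordCompl_eq_one_iff hp.out, hcompl]
  rw [orderExp_eq_card hf]
  simp only [h1, Nat.card_eq_fintype_card, Fintype.card_subtype]
  exact Finset.card_filter_add_card_filter_not _

theorem card_pow_eq_one_prod (A B : Type*) [Group A] [Group B] (m : ℕ) :
    Nat.card {g : A × B // g ^ m = 1} =
      Nat.card {a : A // a ^ m = 1} * Nat.card {b : B // b ^ m = 1} := by
  rw [← Nat.card_prod]
  exact Nat.card_congr
    { toFun := fun g => (⟨g.1.1, congrArg Prod.fst g.2⟩, ⟨g.1.2, congrArg Prod.snd g.2⟩)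
      invFun := fun x => ⟨(x.1.1, x.2.1), Prod.ext x.1.2 x.2.2⟩
      left_inv := fun _ => rfl
      right_inv := fun _ => rfl }

theorem card_pow_eq_one_Z14 (m : ℕ) : Nat.card {a : Multiplicative (ZMod 14) // a ^ m = 1} =
    (Finset.univ.filter fun a : ZMod 14 => m * a = 0).card := by
  rw [← Fintype.card_subtype, ← Nat.card_eq_fintype_card]
  refine Nat.card_congr (Equiv.subtypeEquiv Multiplicative.toAdd fun a => ?_)
  rw [← toAdd_eq_zero, toAdd_pow, nsmul_eq_mul]

theorem card_pow_eq_one_Z13Z3 (m : ℕ) : Nat.card {b : Z13Z3 // b ^ m = 1} =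
    (Finset.univ.filter fun x : Multiplicative (ZMod 13) × Multiplicative (ZMod 3) =>
      (⟨x.1, x.2⟩ : Z13Z3) ^ m = 1).card := by
  rw [← Fintype.card_subtype, ← Nat.card_eq_fintype_card]
  exact Nat.card_congr (Equiv.subtypeEquiv SemidirectProduct.equivProd fun a => Iff.rfl)

theorem card_pow_273_Z13Z3 :
    (Finset.univ.filter fun x : Multiplicative (ZMod 13) × Multiplicative (ZMod 3) =>
      (⟨x.1, x.2⟩ : Z13Z3) ^ 273 = 1).card = 39 := by
  decide +kernel

theorem card_pow_182_Z13Z3 :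
    (Finset.univ.filter fun x : Multiplicative (ZMod 13) × Multiplicative (ZMod 3) =>
      (⟨x.1, x.2⟩ : Z13Z3) ^ 182 = 1).card = 13 := by
  decide +kernel

theorem card_pow_78_Z13Z3 :
    (Finset.univ.filter fun x : Multiplicative (ZMod 13) × Multiplicative (ZMod 3) =>
      (⟨x.1, x.2⟩ : Z13Z3) ^ 78 = 1).card = 39 := by
  decide +kernel

theorem card_pow_42_Z13Z3 :
    (Finset.univ.filter fun x : Multiplicative (ZMod 13) × Multiplicative (ZMod 3) =>
      (⟨x.1, x.2⟩ : Z13Z3) ^ 42 = 1).card = 27 := by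
  decide +kernel

theorem orderExp_Z14Z13Z3 : orderExp 2 Z14Z13Z3 = 273 ∧ orderExp 3 Z14Z13Z3 = 364 ∧
    orderExp 7 Z14Z13Z3 = 468 ∧ orderExp 13 Z14Z13Z3 = 168 := by
  have := Fact.mk Nat.prime_two
  have := Fact.mk Nat.prime_three
  have : Fact (Nat.Prime 7) := ⟨by norm_num⟩
  have h2 := orderExp_add_card_pow_eq_one (p := 2) (m := 273) card_Z14Z13Z3 (by norm_num)
  have h3 := orderExp_add_card_pow_eq_one (p := 3) (m := 182) card_Z14Z13Z3 (by norm_num)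
  have h7 := orderExp_add_card_pow_eq_one (p := 7) (m := 78) card_Z14Z13Z3 (by norm_num)
  have h13 := orderExp_add_card_pow_eq_one (p := 13) (m := 42) card_Z14Z13Z3 (by norm_num)
  rw [card_pow_eq_one_prod, card_Z14Z13Z3, card_pow_eq_one_Z14, card_pow_eq_one_Z13Z3]
    at h2 h3 h7 h13
  rw [show (Finset.univ.filter fun a : ZMod 14 => (273 : ℕ) * a = 0).card = 7 by decide +kernel,
    card_pow_273_Z13Z3] at h2
  rw [show (Finset.univ.filter fun a : ZMod 14 => (182 : ℕ) * a = 0).card = 14 by decide +kernel,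
    card_pow_182_Z13Z3] at h3
  rw [show (Finset.univ.filter fun a : ZMod 14 => (78 : ℕ) * a = 0).card = 2 by decide +kernel,
    card_pow_78_Z13Z3] at h7
  rw [show (Finset.univ.filter fun a : ZMod 14 => (42 : ℕ) * a = 0).card = 14 by decide +kernel,
    card_pow_42_Z13Z3] at h13
  omega

theorem mainTheorem5 (G : Type*) [Group G] [Finite G] :
    ExpRho PSL2_13 = {168, 273, 364, 468} ∧
    (ExpRho G = ExpRho PSL2_13 ↔ (Nonempty (G ≃* PSL2_13) ∨ Nonempty (G ≃* Z14Z13Z3))) ∧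
    ((ExpRho G = ExpRho PSL2_13 ∧ Nat.card G = Nat.card PSL2_13) ↔ Nonempty (G ≃* PSL2_13)) := by
  have hPSL : ExpRho PSL2_13 = {168, 273, 364, 468} := by
    obtain ⟨h2, h3, h7, h13⟩ := orderExp_PSL2_13
    exact ExpRho_eq_of_orderExp (Or.inr card_PSL2_13) h2 h3 h7 h13
  have hZ : ExpRho Z14Z13Z3 = {168, 273, 364, 468} := by
    obtain ⟨h2, h3, h7, h13⟩ := orderExp_Z14Z13Z3
    exact ExpRho_eq_of_orderExp (Or.inl card_Z14Z13Z3) h2 h3 h7 h13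
  refine ⟨hPSL, ⟨fun h => ?_, ?_⟩, ⟨fun h => ?_, ?_⟩⟩
  · obtain ⟨hG | hG, h2, h3, h7, h13⟩ := card_of_ExpRho_eq (h.trans hPSL)
    · obtain ⟨z, x, y, hz, hx, hy, hzx, hzy, hyx⟩ := exists_generators_of_card_546 hG h2 h3 h7 h13
      exact Or.inr (nonempty_mulEquiv_Z14Z13Z3 hG hz hx hy hzx hzy hyx)
    · exact Or.inl (nonempty_mulEquiv_of_card_1092 hG h2 h13)
  · rintro (⟨⟨e⟩⟩ | ⟨⟨e⟩⟩)
    · exact ExpRho_congr e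
    · exact (ExpRho_congr e).trans (hZ.trans hPSL.symm)
  · obtain ⟨-, h2, -, -, h13⟩ := card_of_ExpRho_eq (h.1.trans hPSL)
    exact nonempty_mulEquiv_of_card_1092 (h.2.trans card_PSL2_13) h2 h13
  · rintro ⟨e⟩
    exact ⟨ExpRho_congr e, Nat.card_congr e.toEquiv⟩
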